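/- Let $1<p<2$, $d\ge 2$, and let $M\subset\mathbb{R}^d$ be a compact $d$-dimensional manifold with nonempty Lipschitz boundary (that is, $\partial M \neq\emptyset$ and near each boundary point $M$ is, after a rotation, the closed epigraph of a Lipschitz function). Let $T:M\to M$ be a volume-preserving $C^1$-diffeomorphism, and put $T_*u:=u\circ T^{-1}$. Let $W^{1,p}_0(M)$ be the closure of $C_c^\infty(\operatorname{int} M)$ in $W^{1,p}(M)$, and write $\|f\|_p$ for the $L^p(M)$ norm of the pointwise Euclidean length of $f$. Then $T_*$ maps $W^{1,p}_0(M)$ into itself, the infimum $$\lambda^D_p(M,T):=\inf_{u\in W^{1,p}_0(M)\setminus\{0\}}\frac{\|\nabla u\|_p^p+\|\nabla T_*u\|_p^p}{2\|u\|_p^p}$$ is positive, and it is attained by some $u\in W^{1,p}_0(M)\setminus\{0\}$ which is a weak solution of $-\Delta^D_pu=\lambda^D_p(M,T)\,|u|^{p-2}u$, that is, for all $v\in W^{1,p}_0(M)$, $$\frac12\left(\int_M|\nabla u|^{p-2}\nabla u\cdot\nabla v+\int_M|\nabla T_*u|^{p-2}\nabla T_*u\cdot\nabla T_*v\right)=\lambda^D_p(M,T)\int_M|u|^{p-2}u\,v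 ,$$ where $|\xi|^{p-2}\xi$ is read as $0$ at $\xi=0$. -/

import Mathlib

open MeasureTheory Set Filter Topology
open scoped ENNReal NNReal ContDiff Gradient

noncomputable section

namespace DynPLaplace

/-- `M ⊆ ℝ^d` has Lipschitz boundary: near every boundary point, in a suitable orthonormal
coordinate system with last axis `e`, the set `M` is the closed epigraph of a Lipschitz function
`γ` of the coordinates orthogonal to `e`. -/
def HasLipschitzBoundary {d : ℕ} (M : Set (EuclideanSpace ℝ (Fin d))) : Prop :=
  ∀ x ∈ frontier M, ∃ (U : Set (EuclideanSpace ℝ (Fin d))) (e : EuclideanSpace ℝ (Fin d))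
    (γ : (ℝ ∙ e)ᗮ → ℝ) (K : ℝ≥0),
    IsOpen U ∧ x ∈ U ∧ ‖e‖ = 1 ∧ LipschitzWith K γ ∧
      M ∩ U = {y | γ ((ℝ ∙ e)ᗮ.orthogonalProjectionOnto y) ≤ inner ℝ e y} ∩ U

/-- A volume-preserving `C¹`-diffeomorphism `T : M → M` (with inverse `T.symm`), `C¹` up to the
boundary of `M` in both directions. -/
structure IsVolumePreservingDiffeo {d : ℕ} (M : Set (EuclideanSpace ℝ (Fin d)))
    (T : PartialEquiv (EuclideanSpace ℝ (Fin d)) (EuclideanSpace ℝ (Fin d))) : Prop where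
  source_eq : T.source = M
  target_eq : T.target = M
  contDiffOn : ContDiffOn ℝ 1 T M
  contDiffOn_symm : ContDiffOn ℝ 1 T.symm M
  volume_image : ∀ A ⊆ M, MeasurableSet A → volume (T '' A) = volume A

/-- `φ ∈ C_c^∞(Ω)`. -/
structure IsTestFunction {d : ℕ} (Ω : Set (EuclideanSpace ℝ (Fin d)))
    (φ : EuclideanSpace ℝ (Fin d) → ℝ) : Prop where
  contDiff : ContDiff ℝ ∞ φ
  hasCompactSupport : HasCompactSupport φ
  tsupport_subset : tsupport φ ⊆ Ω

/-- `g` is a weak gradient of `u` on the open set `Ω`. -/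
structure HasWeakGradient {d : ℕ} (Ω : Set (EuclideanSpace ℝ (Fin d)))
    (u : EuclideanSpace ℝ (Fin d) → ℝ)
    (g : EuclideanSpace ℝ (Fin d) → EuclideanSpace ℝ (Fin d)) : Prop where
  locallyIntegrableOn : LocallyIntegrableOn u Ω
  locallyIntegrableOn_grad : LocallyIntegrableOn g Ω
  integral_eq : ∀ φ, IsTestFunction Ω φ →
    ∫ x in Ω, u x • ∇ φ x = - ∫ x in Ω, φ x • g x

open Classical in
/-- The weak gradient of `u` in the interior of `M` (unique up to null sets), if it exists. -/
def weakGradient {d : ℕ} (M : Set (EuclideanSpace ℝ (Fin d)))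
    (u : EuclideanSpace ℝ (Fin d) → ℝ) : EuclideanSpace ℝ (Fin d) → EuclideanSpace ℝ (Fin d) :=
  if h : ∃ g, HasWeakGradient (interior M) u g then h.choose else 0

/-- `u ∈ W^{1,p}(M)`: `u ∈ L^p(M)` has a weak gradient in the interior of `M`, which is in
`L^p(M)`. Functions are relevant only up to equality almost everywhere on `M`. -/
structure MemW {d : ℕ} (p : ℝ) (M : Set (EuclideanSpace ℝ (Fin d)))
    (u : EuclideanSpace ℝ (Fin d) → ℝ) : Prop where
  memLp : MemLp u (ENNReal.ofReal p) (volume.restrict M)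
  exists_weakGradient : ∃ g, HasWeakGradient (interior M) u g
  memLp_weakGradient : MemLp (weakGradient M u) (ENNReal.ofReal p) (volume.restrict M)

/-- `u ∈ W_0^{1,p}(M)`: `u` is in the closure of `C_c^∞(int M)` in `W^{1,p}(M)`. -/
structure MemW0 {d : ℕ} (p : ℝ) (M : Set (EuclideanSpace ℝ (Fin d)))
    (u : EuclideanSpace ℝ (Fin d) → ℝ) : Prop where
  memW : MemW p M u
  exists_approx : ∃ φ : ℕ → EuclideanSpace ℝ (Fin d) → ℝ,
    (∀ n, IsTestFunction (interior M) (φ n)) ∧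
    Tendsto (fun n => eLpNorm (fun x => u x - φ n x) (ENNReal.ofReal p) (volume.restrict M))
      atTop (𝓝 0) ∧
    Tendsto (fun n => eLpNorm (fun x => weakGradient M u x - ∇ (φ n) x) (ENNReal.ofReal p)
      (volume.restrict M)) atTop (𝓝 0)

/-- The pushforward `T_* u = u ∘ T⁻¹`. -/
def pushforward {d : ℕ}
    (T : PartialEquiv (EuclideanSpace ℝ (Fin d)) (EuclideanSpace ℝ (Fin d)))
    (u : EuclideanSpace ℝ (Fin d) → ℝ) : EuclideanSpace ℝ (Fin d) → ℝ :=
  u ∘ T.symm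

/-- `F(u) = ‖∇u‖_p^p`. -/
def F {d : ℕ} (p : ℝ) (M : Set (EuclideanSpace ℝ (Fin d)))
    (u : EuclideanSpace ℝ (Fin d) → ℝ) : ℝ :=
  ∫ x in M, ‖weakGradient M u x‖ ^ p

/-- `F^D(u) = (‖∇u‖_p^p + ‖∇T_*u‖_p^p) / 2`. -/
def dynF {d : ℕ} (p : ℝ) (M : Set (EuclideanSpace ℝ (Fin d)))
    (T : PartialEquiv (EuclideanSpace ℝ (Fin d)) (EuclideanSpace ℝ (Fin d)))
    (u : EuclideanSpace ℝ (Fin d) → ℝ) : ℝ :=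
  (F p M u + F p M (pushforward T u)) / 2

/-- `G(u) = ‖u‖_p^p`. -/
def G {d : ℕ} (p : ℝ) (M : Set (EuclideanSpace ℝ (Fin d)))
    (u : EuclideanSpace ℝ (Fin d) → ℝ) : ℝ :=
  ∫ x in M, |u x| ^ p

/-- The Rayleigh quotient `J^D(u) = F^D(u) / G(u)`. -/
def dynJ {d : ℕ} (p : ℝ) (M : Set (EuclideanSpace ℝ (Fin d)))
    (T : PartialEquiv (EuclideanSpace ℝ (Fin d)) (EuclideanSpace ℝ (Fin d)))
    (u : EuclideanSpace ℝ (Fin d) → ℝ) : ℝ :=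
  dynF p M T u / G p M u

/-- The nonzero elements of `W_0^{1,p}(M)`. -/
def nonzeroW0 {d : ℕ} (p : ℝ) (M : Set (EuclideanSpace ℝ (Fin d))) :
    Set (EuclideanSpace ℝ (Fin d) → ℝ) :=
  {u | MemW0 p M u ∧ ¬ u =ᵐ[volume.restrict M] 0}

/-- `λ^D_p(M, T)`, the infimum of `J^D` over the nonzero elements of `W_0^{1,p}(M)`. -/
def dynLambda {d : ℕ} (p : ℝ) (M : Set (EuclideanSpace ℝ (Fin d)))
    (T : PartialEquiv (EuclideanSpace ℝ (Fin d)) (EuclideanSpace ℝ (Fin d))) : ℝ :=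
  sInf (dynJ p M T '' nonzeroW0 p M)

/-- The `p`-Laplacian in weak form, `(Δ_p u) v = -∫_M |∇u|^{p-2} ∇u · ∇v`. -/
def pLaplacian {d : ℕ} (p : ℝ) (M : Set (EuclideanSpace ℝ (Fin d)))
    (u v : EuclideanSpace ℝ (Fin d) → ℝ) : ℝ :=
  - ∫ x in M, ‖weakGradient M u x‖ ^ (p - 2) * inner ℝ (weakGradient M u x) (weakGradient M v x)

/-- The dynamic `p`-Laplacian in weak form,
`(Δ^D_p u) v = ((Δ_p u) v + (Δ_p T_* u) (T_* v)) / 2`. -/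
def dynPLaplacian {d : ℕ} (p : ℝ) (M : Set (EuclideanSpace ℝ (Fin d)))
    (T : PartialEquiv (EuclideanSpace ℝ (Fin d)) (EuclideanSpace ℝ (Fin d)))
    (u v : EuclideanSpace ℝ (Fin d) → ℝ) : ℝ :=
  (pLaplacian p M u v + pLaplacian p M (pushforward T u) (pushforward T v)) / 2

/-- `u` is a weak solution of `-Δ^D_p u = c |u|^{p-2} u`. -/
def IsWeakEigenfunction {d : ℕ} (p : ℝ) (M : Set (EuclideanSpace ℝ (Fin d)))
    (T : PartialEquiv (EuclideanSpace ℝ (Fin d)) (EuclideanSpace ℝ (Fin d)))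
    (c : ℝ) (u : EuclideanSpace ℝ (Fin d) → ℝ) : Prop :=
  ∀ v, MemW0 p M v →
    - dynPLaplacian p M T u v = c * ∫ x in M, |u x| ^ (p - 2) * u x * v x

end DynPLaplace

end

/-! The proof is the direct method, with uniform convexity in place of weak convergence.
`W_0^{1,p}(M)` is realised as the closure in `L^p × L^p` of the pairs `(φ, ∇φ)`, and the problem
lives on the closed space of triples `(u, ∇u, ∇T_*u)`.

Take a minimizing sequence with `‖u_n‖_p = 1`. The Rellich–Kondrachov theorem
(`totallyBounded_of_mem_sobolevZero`) gives a subsequence converging in `L^p`, so the midpoints of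
`u_m` and `u_n` have norm tending to `1`. Their energy is therefore asymptotically at least the
infimum, and the convexity gap of `‖·‖^p` along the gradients tends to `0`. By
`exists_lp_norm_sub_rpow_le` both gradient sequences are then Cauchy, and the limit is a minimizer
(`exists_minimizer`). Poincaré's inequality makes its energy positive, and differentiating along
lines through it gives the equation (`integral_eq_of_minimizer`).

Invariance under `T_*` (`exists_mem_sobolevZero`) is proved on test functions: `φ ∘ T⁻¹` is `C^1`
with compact support in the interior, hence a limit of test functions by mollification. Since `DT⁻¹`
is bounded and `T` preserves volume, the gradient norm grows by at most a constant factor, and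
density finishes. The Lipschitz boundary serves to make the frontier a null set and, being nonempty,
to give `M` interior points. -/

noncomputable section

namespace DynPLaplace

/-! ### Uniform convexity of `‖·‖ ^ p`, pointwise and in `L^p` -/

section UniformConvexity

variable {E : Type*} [NormedAddCommGroup E] [NormedSpace ℝ E]

/-- If the norms agree, strict convexity of the ball gives the strict inequality; if they differ,
strict convexity of `t ↦ t ^ p` does. -/
theorem norm_rpow_midpoint_lt [StrictConvexSpace ℝ E] {p : ℝ} (hp : 1 < p) {a b : E}
    (hab : a ≠ b) : ‖(2⁻¹ : ℝ) • (a + b)‖ ^ p < (‖a‖ ^ p + ‖b‖ ^ p) / 2 := by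
  have h2 : ‖(2⁻¹ : ℝ) • (a + b)‖ = 2⁻¹ * ‖a + b‖ := by rw [norm_smul]; norm_num
  rcases eq_or_ne ‖a‖ ‖b‖ with h | h
  · have hlt : ‖(2⁻¹ : ℝ) • (a + b)‖ < ‖a‖ := by
      have := (norm_combo_lt_of_ne le_rfl h.ge hab (by norm_num : (0 : ℝ) < 2⁻¹)
        (by norm_num : (0 : ℝ) < 2⁻¹) (by norm_num))
      rwa [← smul_add] at this
    have := Real.rpow_lt_rpow (norm_nonneg _) hlt (by linarith : 0 < p)
    rw [← h]; linarith
  · have h1 : ‖(2⁻¹ : ℝ) • (a + b)‖ ≤ 2⁻¹ * ‖a‖ + 2⁻¹ * ‖b‖ := by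
      rw [h2]; linarith [norm_add_le a b]
    have h3 := (strictConvexOn_rpow hp).2 (mem_Ici.2 (norm_nonneg a)) (mem_Ici.2 (norm_nonneg b)) h
      (by norm_num : (0 : ℝ) < 2⁻¹) (by norm_num : (0 : ℝ) < 2⁻¹) (by norm_num)
    have h4 := Real.rpow_le_rpow (norm_nonneg _) h1 (by linarith : 0 ≤ p)
    simp only [smul_eq_mul] at h3
    linarith

/-- A soft form of the uniform convexity of `‖·‖ ^ p`. -/
theorem exists_norm_sub_rpow_le [StrictConvexSpace ℝ E] [FiniteDimensional ℝ E] {p : ℝ}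
    (hp : 1 < p) {δ : ℝ} (hδ : 0 < δ) :
    ∃ C : ℝ, 0 ≤ C ∧ ∀ a b : E, ‖a - b‖ ^ p ≤ δ * (‖a‖ ^ p + ‖b‖ ^ p) +
      C * ((‖a‖ ^ p + ‖b‖ ^ p) / 2 - ‖(2⁻¹ : ℝ) • (a + b)‖ ^ p) := by
  have hp0 : 0 < p := by linarith
  have : ProperSpace (E × E) := FiniteDimensional.proper_real _
  have hgap : ∀ a b : E, 0 ≤ (‖a‖ ^ p + ‖b‖ ^ p) / 2 - ‖(2⁻¹ : ℝ) • (a + b)‖ ^ p := by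
    intro a b
    rcases eq_or_ne a b with rfl | h
    · rw [← two_smul ℝ a, smul_smul]; norm_num
    · linarith [norm_rpow_midpoint_lt hp h]
  let g : E × E → ℝ := fun w => (‖w.1‖ ^ p + ‖w.2‖ ^ p) / 2 - ‖(2⁻¹ : ℝ) • (w.1 + w.2)‖ ^ p
  have hc : ∀ f : E × E → ℝ, Continuous f → Continuous fun w => f w ^ p := fun f hf =>
    hf.rpow_const fun _ => Or.inr hp0.le
  have hg : Continuous g := by
    have h1 := hc (fun w => ‖w.1‖) (by fun_prop)
    have h2 := hc (fun w => ‖w.2‖) (by fun_prop)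
    have h3 := hc (fun w => ‖(2⁻¹ : ℝ) • (w.1 + w.2)‖) (by fun_prop)
    exact ((h1.add h2).div_const 2).sub h3
  -- All terms are homogeneous of degree `p` in `(a, b)`, so the unit sphere suffices. Where `‖a -
  -- b‖ ^ p` is below the `δ` term nothing is to be shown; `K` is the compact remainder, on which `a
  -- ≠ b` and the gap `g` has a positive lower bound.
  let K : Set (E × E) := Metric.sphere 0 1 ∩
    {w | δ * (‖w.1‖ ^ p + ‖w.2‖ ^ p) ≤ ‖w.1 - w.2‖ ^ p}
  have hK : IsCompact K := by
    refine (isCompact_sphere _ _).inter_right (isClosed_le ?_ ?_)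
    · have h1 := hc (fun w => ‖w.1‖) (by fun_prop)
      have h2 := hc (fun w => ‖w.2‖) (by fun_prop)
      exact (h1.add h2).const_mul δ
    · exact hc (fun w => ‖w.1 - w.2‖) (by fun_prop)
  have hpos : ∀ w ∈ K, 0 < g w := by
    rintro ⟨a, b⟩ ⟨h1, h2⟩
    have hab : a ≠ b := by
      rintro rfl
      have ha : 0 < ‖a‖ := by
        simp only [mem_sphere_iff_norm, sub_zero, Prod.norm_mk, max_self] at h1
        linarith
      have := Real.rpow_pos_of_pos ha p
      simp only [mem_ofPred_eq, sub_self, norm_zero, Real.zero_rpow hp0.ne'] at h2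
      nlinarith
    have := norm_rpow_midpoint_lt hp hab
    simp only [g]; linarith
  obtain ⟨m, hm, hmK⟩ : ∃ m, 0 < m ∧ ∀ w ∈ K, m ≤ g w := by
    rcases K.eq_empty_or_nonempty with h | h
    · exact ⟨1, one_pos, by simp [h]⟩
    · obtain ⟨w, hw, hmin⟩ := hK.exists_isMinOn h hg.continuousOn
      exact ⟨g w, hpos w hw, fun v hv => hmin hv⟩
  -- On the unit sphere `‖a - b‖ ≤ 2` while the gap is at least `m` on `K`.
  refine ⟨2 ^ p / m, by positivity, fun a b => ?_⟩
  rcases eq_or_ne (a, b) 0 with h0 | h0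
  · obtain ⟨rfl, rfl⟩ := Prod.mk_eq_zero.1 h0
    simp [Real.zero_rpow hp0.ne']
  by_cases hle : ‖a - b‖ ^ p ≤ δ * (‖a‖ ^ p + ‖b‖ ^ p)
  · have := mul_nonneg (by positivity : 0 ≤ 2 ^ p / m) (hgap a b)
    linarith
  push Not at hle
  set r := ‖(a, b)‖ with hr
  have hr0 : 0 < r := norm_pos_iff.2 h0
  have hrp : 0 < r⁻¹ ^ p := by positivity
  have hs : ∀ x : E, ‖r⁻¹ • x‖ ^ p = r⁻¹ ^ p * ‖x‖ ^ p := fun x => by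
    rw [norm_smul, Real.mul_rpow (norm_nonneg _) (norm_nonneg _), Real.norm_of_nonneg (by positivity)]
  have hw : (r⁻¹ • a, r⁻¹ • b) ∈ K := by
    refine ⟨?_, ?_⟩
    · rw [mem_sphere_iff_norm, sub_zero, ← Prod.smul_mk, norm_smul, norm_inv, norm_norm, ← hr]
      exact inv_mul_cancel₀ hr0.ne'
    · simp only [mem_ofPred_eq, ← smul_sub, hs]
      nlinarith
  have h5 := hmK _ hw
  simp only [g, ← smul_add, smul_comm (2⁻¹ : ℝ) r⁻¹, hs] at h5
  have h6 : ‖a - b‖ ≤ 2 * r := by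
    have h1 : ‖a‖ ≤ r := norm_fst_le (a, b)
    have h2 : ‖b‖ ≤ r := norm_snd_le (a, b)
    linarith [norm_sub_le a b]
  have h7 : r⁻¹ ^ p * ‖a - b‖ ^ p ≤ 2 ^ p := by
    rw [← Real.mul_rpow (by positivity) (norm_nonneg _)]
    refine Real.rpow_le_rpow (by positivity) ?_ hp0.le
    rw [inv_mul_le_iff₀ hr0]; linarith
  set D := (‖a‖ ^ p + ‖b‖ ^ p) / 2 - ‖(2⁻¹ : ℝ) • (a + b)‖ ^ p with hD
  have h8 : m ≤ r⁻¹ ^ p * D := by rw [hD]; linarith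
  have h9 : r⁻¹ ^ p * ‖a - b‖ ^ p ≤ r⁻¹ ^ p * (2 ^ p / m * D) := by
    calc _ ≤ 2 ^ p := h7
      _ = 2 ^ p / m * m := by field_simp
      _ ≤ 2 ^ p / m * (r⁻¹ ^ p * D) := by gcongr
      _ = _ := by ring
  have := le_of_mul_le_mul_left h9 hrp
  have : 0 ≤ δ * (‖a‖ ^ p + ‖b‖ ^ p) := by positivity
  linarith

theorem lp_norm_rpow {E : Type*} [NormedAddCommGroup E] {α : Type*} [MeasurableSpace α] {μ : Measure α} {p : ℝ} (hp : 0 < p)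
    (f : Lp E (ENNReal.ofReal p) μ) : ‖f‖ ^ p = ∫ x, ‖f x‖ ^ p ∂μ := by
  have h0 : 0 ≤ ∫ x, ‖f x‖ ^ p ∂μ := integral_nonneg fun x => by positivity
  rw [Lp.norm_def, (Lp.memLp f).eLpNorm_eq_integral_rpow_norm (by simpa using hp)
    ENNReal.ofReal_ne_top, ENNReal.toReal_ofReal hp.le, ENNReal.toReal_ofReal (by positivity),
    Real.rpow_inv_rpow h0 hp.ne']

theorem integrable_lp_norm_rpow {E : Type*} [NormedAddCommGroup E] {α : Type*} [MeasurableSpace α] {μ : Measure α} {p : ℝ}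
    (hp : 0 < p) (f : Lp E (ENNReal.ofReal p) μ) : Integrable (fun x => ‖f x‖ ^ p) μ := by
  have := (Lp.memLp f).integrable_norm_rpow (by simpa using hp) ENNReal.ofReal_ne_top
  rwa [ENNReal.toReal_ofReal hp.le] at this

/-- The pointwise inequality integrates as it stands, because `C` does not depend on the vectors.
This plays the role of Clarkson's inequalities and has the same form for all `p > 1`. -/
theorem exists_lp_norm_sub_rpow_le [StrictConvexSpace ℝ E] [FiniteDimensional ℝ E]
    {α : Type*} [MeasurableSpace α] {μ : Measure α} {p : ℝ} (hp : 1 < p) {δ : ℝ} (hδ : 0 < δ) :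
    ∃ C : ℝ, 0 ≤ C ∧ ∀ a b : Lp E (ENNReal.ofReal p) μ, ‖a - b‖ ^ p ≤ δ * (‖a‖ ^ p + ‖b‖ ^ p) +
      C * ((‖a‖ ^ p + ‖b‖ ^ p) / 2 - ‖(2⁻¹ : ℝ) • (a + b)‖ ^ p) := by
  have hp0 : 0 < p := by linarith
  obtain ⟨C, hC, h⟩ := exists_norm_sub_rpow_le (E := E) hp hδ
  refine ⟨C, hC, fun a b => ?_⟩
  have ha := integrable_lp_norm_rpow hp0 a
  have hb := integrable_lp_norm_rpow hp0 b
  have hab := integrable_lp_norm_rpow hp0 ((2⁻¹ : ℝ) • (a + b))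
  simp only [lp_norm_rpow hp0]
  rw [← integral_add ha hb, ← integral_const_mul, ← integral_div, ← integral_sub _ hab,
    ← integral_const_mul, ← integral_add]
  · refine integral_mono_ae (integrable_lp_norm_rpow hp0 _) ?_ ?_
    · exact ((ha.add hb).const_mul δ).add ((((ha.add hb).div_const 2).sub hab).const_mul C)
    · filter_upwards [Lp.coeFn_sub a b, Lp.coeFn_add a b, Lp.coeFn_smul (2⁻¹ : ℝ) (a + b)]
        with x h1 h2 h3
      simp only [h1, h3, Pi.sub_apply, Pi.smul_apply, h2, Pi.add_apply]
      exact h _ _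
  · exact (ha.add hb).const_mul δ
  · exact (((ha.add hb).div_const 2).sub hab).const_mul C
  · exact (ha.add hb).div_const 2

end UniformConvexity

/-! ### The direct method in an abstract setting -/

section Minimizer

variable {X Y : Type*} [NormedAddCommGroup X] [NormedSpace ℝ X] [CompleteSpace X]
  [NormedAddCommGroup Y] [NormedSpace ℝ Y] [CompleteSpace Y]

/-- Existence of a minimizer of `(‖y‖ ^ p + ‖z‖ ^ p) / 2` under the constraint `‖x‖ = 1` among
the elements `(x, y, z)` of a closed subspace in which bounds on `y` make `x` range over a
totally bounded set. -/
theorem exists_minimizer {p : ℝ} (hp : 1 < p)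
    (hY : ∀ δ : ℝ, 0 < δ → ∃ C : ℝ, 0 ≤ C ∧ ∀ a b : Y, ‖a - b‖ ^ p ≤ δ * (‖a‖ ^ p + ‖b‖ ^ p) +
      C * ((‖a‖ ^ p + ‖b‖ ^ p) / 2 - ‖(2⁻¹ : ℝ) • (a + b)‖ ^ p))
    (W : Submodule ℝ (X × Y × Y)) (hW : IsClosed (W : Set (X × Y × Y)))
    (htb : ∀ R : ℝ, TotallyBounded {x : X | ∃ w ∈ W, w.1 = x ∧ ‖w.2.1‖ ≤ R})
    (hne : ∃ w ∈ W, w.1 ≠ 0) :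
    ∃ w ∈ W, ‖w.1‖ = 1 ∧ ∀ v ∈ W,
      (‖w.2.1‖ ^ p + ‖w.2.2‖ ^ p) / 2 * ‖v.1‖ ^ p ≤ (‖v.2.1‖ ^ p + ‖v.2.2‖ ^ p) / 2 := by
  have hp0 : 0 < p := by linarith
  set N : X × Y × Y → ℝ := fun w => (‖w.2.1‖ ^ p + ‖w.2.2‖ ^ p) / 2 with hN
  have hN0 : ∀ w, 0 ≤ N w := fun w => by simp only [hN]; positivity
  have hrc : Continuous fun t : ℝ => t ^ p := Real.continuous_rpow_const hp0.le
  have hNc : Continuous N :=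
    ((hrc.comp (by fun_prop : Continuous fun w : X × Y × Y => ‖w.2.1‖)).add
      (hrc.comp (by fun_prop : Continuous fun w : X × Y × Y => ‖w.2.2‖))).div_const 2
  have hNs : ∀ (c : ℝ) (w), N (c • w) = |c| ^ p * N w := fun c w => by
    simp only [hN, Prod.smul_snd, Prod.smul_fst, norm_smul, Real.norm_eq_abs,
      Real.mul_rpow (abs_nonneg c) (norm_nonneg _)]
    ring
  set S : Set ℝ := N '' {w | w ∈ W ∧ ‖w.1‖ = 1} with hS
  have hbdd : BddBelow S := ⟨0, by rintro _ ⟨w, -, rfl⟩; exact hN0 w⟩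
  have hSne : S.Nonempty := by
    obtain ⟨w, hw, h0⟩ := hne
    refine ⟨_, ‖w.1‖⁻¹ • w, ⟨W.smul_mem _ hw, ?_⟩, rfl⟩
    rw [Prod.smul_fst, norm_smul, norm_inv, norm_norm, inv_mul_cancel₀ (norm_ne_zero_iff.2 h0)]
  set l := sInf S with hl
  -- By homogeneity the infimum over `‖x‖ = 1` becomes an inequality on all of `W`, so that it can
  -- be applied to midpoints, whose first component is not normalised.
  have hlow : ∀ v ∈ W, l * ‖v.1‖ ^ p ≤ N v := by
    intro v hv
    rcases eq_or_ne v.1 0 with h0 | h0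
    · simpa [h0, Real.zero_rpow hp0.ne'] using hN0 v
    · have hpos : 0 < ‖v.1‖ := norm_pos_iff.2 h0
      have h1 : l ≤ N (‖v.1‖⁻¹ • v) := csInf_le hbdd ⟨_, ⟨W.smul_mem _ hv, by
        rw [Prod.smul_fst, norm_smul, norm_inv, norm_norm, inv_mul_cancel₀ hpos.ne']⟩, rfl⟩
      rw [hNs, abs_of_pos (by positivity), Real.inv_rpow hpos.le] at h1
      rwa [← div_eq_inv_mul, le_div_iff₀ (by positivity)] at h1
  obtain ⟨s, -, hs, hsS⟩ := exists_seq_tendsto_sInf hSne hbdd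
  choose w hwW hws using hsS
  obtain ⟨B, hB⟩ := hs.bddAbove_range
  have hbound : ∀ n, ‖(w n).2.1‖ ≤ (2 * B) ^ p⁻¹ := fun n => by
    have h1 : N (w n) ≤ B := by rw [hws]; exact hB ⟨n, rfl⟩
    have h2 : 0 ≤ ‖(w n).2.2‖ ^ p := by positivity
    have h3 : ‖(w n).2.1‖ ^ p ≤ 2 * B := by simp only [hN] at h1; linarith
    have := Real.rpow_le_rpow (by positivity) h3 (by positivity : 0 ≤ p⁻¹)
    rwa [Real.rpow_rpow_inv (norm_nonneg _) hp0.ne'] at this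
  obtain ⟨x, -, φ, hφ, hx⟩ := (htb ((2 * B) ^ p⁻¹)).closure.isCompact_of_isClosed
    isClosed_closure |>.tendsto_subseq (x := fun n => (w n).1)
    (fun n => subset_closure ⟨w n, (hwW n).1, rfl, hbound n⟩)
  set u : ℕ → X × Y × Y := fun n => w (φ n) with hu
  have huW : ∀ n, u n ∈ W := fun n => (hwW _).1
  have hu1 : ∀ n, ‖(u n).1‖ = 1 := fun n => (hwW _).2
  have hux : Tendsto (fun n => (u n).1) atTop (𝓝 x) := hx
  have huN : Tendsto (fun n => N (u n)) atTop (𝓝 l) := by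
    simp only [hu, hws]
    exact hs.comp hφ.tendsto_atTop
  have hx1 : ‖x‖ = 1 := tendsto_nhds_unique hux.norm (by simp only [hu1]; exact tendsto_const_nhds)
  have hl0 : 0 ≤ l := le_csInf hSne (by rintro _ ⟨w, -, rfl⟩; exact hN0 w)
  have h₁ : Tendsto (Prod.fst : ℕ × ℕ → ℕ) atTop atTop := by
    rw [← prod_atTop_atTop_eq]; exact tendsto_fst
  have h₂ : Tendsto (Prod.snd : ℕ × ℕ → ℕ) atTop atTop := by
    rw [← prod_atTop_atTop_eq]; exact tendsto_snd
  have hmid : Tendsto (fun n : ℕ × ℕ => l * ‖(2⁻¹ : ℝ) • ((u n.1).1 + (u n.2).1)‖ ^ p) atTop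
      (𝓝 l) := by
    have h1 := ((hux.comp h₁).add (hux.comp h₂)).const_smul (2⁻¹ : ℝ)
    rw [← two_smul ℝ x, smul_smul] at h1
    norm_num at h1
    have h2 := (hrc.tendsto _).comp h1.norm
    simpa [hx1] using h2.const_mul l
  have key : ∀ ε : ℝ, 0 < ε → ∀ᶠ n : ℕ × ℕ in atTop,
      ‖(u n.1).2.1 - (u n.2).2.1‖ ^ p + ‖(u n.1).2.2 - (u n.2).2.2‖ ^ p < ε := by
    intro ε hε
    -- The bound for the two differences has limit `4 * δ * l`, since its `C` term tends to `0`;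
    -- this `δ` makes the limit smaller than `ε`, and the `+ 1` covers `l = 0`.
    obtain ⟨C, hC, hUC⟩ := hY (ε / (8 * (l + 1))) (by positivity)
    set δ := ε / (8 * (l + 1)) with hδ
    have hlim : Tendsto (fun n : ℕ × ℕ => δ * (2 * N (u n.1) + 2 * N (u n.2)) +
        C * (N (u n.1) + N (u n.2) -
          2 * (l * ‖(2⁻¹ : ℝ) • ((u n.1).1 + (u n.2).1)‖ ^ p))) atTop
        (𝓝 (δ * (2 * l + 2 * l) + C * (l + l - 2 * l))) := by
      have h1 := huN.comp h₁
      have h2 := huN.comp h₂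
      exact (((h1.const_mul 2).add (h2.const_mul 2)).const_mul δ).add
        (((h1.add h2).sub (hmid.const_mul 2)).const_mul C)
    have hlt : δ * (2 * l + 2 * l) + C * (l + l - 2 * l) < ε := by
      have h1 : δ * (8 * (l + 1)) = ε := by rw [hδ]; field_simp
      have h2 : 0 < δ := by positivity
      nlinarith
    filter_upwards [hlim.eventually (gt_mem_nhds hlt)] with n hn
    have h1 := hlow _ (W.smul_mem (2⁻¹ : ℝ) (W.add_mem (huW n.1) (huW n.2)))
    have h2 := hUC (u n.1).2.1 (u n.2).2.1
    have h3 := hUC (u n.1).2.2 (u n.2).2.2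
    refine lt_of_le_of_lt ?_ hn
    simp only [hN, Prod.smul_fst, Prod.smul_snd, Prod.fst_add, Prod.snd_add] at h1 ⊢
    have h4 := mul_le_mul_of_nonneg_left h1 hC
    linarith
  have hcau : ∀ f : X × Y × Y → Y, (∀ a b, ‖f a - f b‖ ^ p ≤
      ‖a.2.1 - b.2.1‖ ^ p + ‖a.2.2 - b.2.2‖ ^ p) → CauchySeq fun n => f (u n) := by
    intro f hf
    rw [cauchySeq_iff_tendsto_dist_atTop_0]
    rw [Metric.tendsto_nhds]
    intro ε hε
    filter_upwards [key (ε ^ p) (by positivity)] with n hn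
    have := (hf _ _).trans_lt hn
    rw [Real.rpow_lt_rpow_iff (norm_nonneg _) hε.le hp0] at this
    simpa [dist_eq_norm] using this
  obtain ⟨y, hy⟩ := cauchySeq_tendsto_of_complete (hcau (fun a => a.2.1) fun a b => by
    have : 0 ≤ ‖a.2.2 - b.2.2‖ ^ p := by positivity
    linarith)
  obtain ⟨z, hz⟩ := cauchySeq_tendsto_of_complete (hcau (fun a => a.2.2) fun a b => by
    have : 0 ≤ ‖a.2.1 - b.2.1‖ ^ p := by positivity
    linarith)
  have hlimu : Tendsto u atTop (𝓝 (x, y, z)) := hux.prodMk_nhds (hy.prodMk_nhds hz)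
  refine ⟨(x, y, z), hW.mem_of_tendsto hlimu (Eventually.of_forall huW), hx1, fun v hv => ?_⟩
  have : N (x, y, z) = l := tendsto_nhds_unique ((hNc.tendsto _).comp hlimu) huN
  rw [show (‖y‖ ^ p + ‖z‖ ^ p) / 2 = l from this]
  exact hlow v hv

end Minimizer

/-! ### Difference quotients and a Rellich–Kondrachov criterion -/

section Compactness

theorem rpow_lintegral_le {α : Type*} [MeasurableSpace α] {ν : Measure α} [IsProbabilityMeasure ν]
    {f : α → ℝ≥0∞} (hf : AEMeasurable f ν) {p : ℝ} (hp : 1 ≤ p) :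
    (∫⁻ x, f x ∂ν) ^ p ≤ ∫⁻ x, f x ^ p ∂ν := by
  have hp0 : 0 < p := by linarith
  have h := eLpNorm'_le_eLpNorm'_of_exponent_le one_pos hp ν hf.aestronglyMeasurable
  simp only [eLpNorm', enorm_eq_self, ENNReal.rpow_one, div_one] at h
  have := ENNReal.rpow_le_rpow h hp0.le
  rwa [one_div, ENNReal.rpow_inv_rpow hp0.ne'] at this

variable {E : Type*} [NormedAddCommGroup E] [NormedSpace ℝ E] [FiniteDimensional ℝ E]
  [MeasurableSpace E] [BorelSpace E] (μ : Measure E) [μ.IsAddHaarMeasure]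

/-- The `L^p` estimate of difference quotients by the gradient. -/
theorem lintegral_enorm_translate_sub_rpow_le {w : E → ℝ} (hw : ContDiff ℝ 1 w) {p : ℝ}
    (hp : 1 ≤ p) (z : E) :
    ∫⁻ x, ‖w (x + z) - w x‖ₑ ^ p ∂μ ≤ ‖z‖ₑ ^ p * ∫⁻ x, ‖fderiv ℝ w x‖ₑ ^ p ∂μ := by
  have hp0 : 0 ≤ p := by linarith
  let ν : Measure ℝ := volume.restrict (Ioc 0 1)
  have : IsProbabilityMeasure ν := ⟨by simp [ν]⟩
  have hcont : Continuous (fderiv ℝ w) := hw.continuous_fderiv one_ne_zero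
  -- The fundamental theorem of calculus on the segment from `x` to `x + z`, followed by Jensen's
  -- inequality in `t`. After Tonelli, translation invariance removes the shift `t • z`.
  have hpt : ∀ x, ‖w (x + z) - w x‖ₑ ^ p ≤
      ∫⁻ t, ‖z‖ₑ ^ p * ‖fderiv ℝ w (x + t • z)‖ₑ ^ p ∂ν := by
    intro x
    have hd : ∀ t : ℝ, HasDerivAt (fun t : ℝ => w (x + t • z)) (fderiv ℝ w (x + t • z) z) t := by
      intro t
      have h1 : HasDerivAt (fun t : ℝ => x + t • z) z t := by
        simpa using ((hasDerivAt_id t).smul_const z).const_add x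
      exact ((hw.differentiable one_ne_zero _).hasFDerivAt).comp_hasDerivAt t h1
    have hc : Continuous fun t : ℝ => fderiv ℝ w (x + t • z) z := by fun_prop
    have h1 := intervalIntegral.integral_eq_sub_of_hasDerivAt (a := 0) (b := 1)
      (fun t _ => hd t) (hc.intervalIntegrable 0 1)
    simp only [one_smul, zero_smul, add_zero] at h1
    rw [← h1, intervalIntegral.integral_of_le zero_le_one]
    calc _ ≤ (∫⁻ t, ‖fderiv ℝ w (x + t • z) z‖ₑ ∂ν) ^ p :=
          ENNReal.rpow_le_rpow (enorm_integral_le_lintegral_enorm _) hp0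
      _ ≤ ∫⁻ t, ‖fderiv ℝ w (x + t • z) z‖ₑ ^ p ∂ν :=
          rpow_lintegral_le hc.enorm.measurable.aemeasurable hp
      _ ≤ _ := by
          refine lintegral_mono fun t => ?_
          rw [← ENNReal.mul_rpow_of_nonneg _ _ hp0, mul_comm]
          exact ENNReal.rpow_le_rpow ((fderiv ℝ w (x + t • z)).le_opENorm z) hp0
  calc _ ≤ ∫⁻ x, ∫⁻ t, ‖z‖ₑ ^ p * ‖fderiv ℝ w (x + t • z)‖ₑ ^ p ∂ν ∂μ := lintegral_mono hpt
    _ = ∫⁻ t, ∫⁻ x, ‖z‖ₑ ^ p * ‖fderiv ℝ w (x + t • z)‖ₑ ^ p ∂μ ∂ν := by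
        refine lintegral_lintegral_swap (Measurable.aemeasurable ?_)
        have : Continuous fun y : E × ℝ => ‖fderiv ℝ w (y.1 + y.2 • z)‖ₑ := by fun_prop
        exact (this.measurable.pow_const p).const_mul _
    _ = ∫⁻ t, ‖z‖ₑ ^ p * ∫⁻ x, ‖fderiv ℝ w x‖ₑ ^ p ∂μ ∂ν := by
        refine lintegral_congr fun t => ?_
        rw [lintegral_const_mul _ (by
          have : Continuous fun x => ‖fderiv ℝ w (x + t • z)‖ₑ := by fun_prop
          exact this.measurable.pow_const p),
          lintegral_add_right_eq_self (fun x => ‖fderiv ℝ w x‖ₑ ^ p)]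
    _ = _ := by simp

theorem enorm_setAverage_rpow_le {E : Type*} [NormedAddCommGroup E] [MeasurableSpace E]
    [BorelSpace E] (μ : Measure E) {s : Set E} (h0 : μ s ≠ 0) (h1 : μ s ≠ ⊤) {f : E → ℝ}
    (hf : Continuous f) {p : ℝ} (hp : 1 ≤ p) :
    ‖⨍ y in s, f y ∂μ‖ₑ ^ p ≤ (μ s)⁻¹ * ∫⁻ y in s, ‖f y‖ₑ ^ p ∂μ := by
  have : IsProbabilityMeasure ((μ s)⁻¹ • μ.restrict s) := ⟨by
    simp [ENNReal.inv_mul_cancel h0 h1]⟩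
  rw [setAverage_eq']
  calc _ ≤ (∫⁻ y, ‖f y‖ₑ ∂((μ s)⁻¹ • μ.restrict s)) ^ p :=
        ENNReal.rpow_le_rpow (enorm_integral_le_lintegral_enorm _) (by linarith)
    _ ≤ _ := rpow_lintegral_le hf.enorm.measurable.aemeasurable hp
    _ = _ := by rw [lintegral_smul_measure, smul_eq_mul]

/-- An `L^p` bound by the gradient and the averages over finitely many balls of radius `h`. -/
theorem setLIntegral_enorm_rpow_le_of_average_le {w : E → ℝ} (hw : ContDiff ℝ 1 w) {p : ℝ}
    (hp : 1 ≤ p) {h : ℝ} (hh : 0 < h) {K : Set E} (hKm : MeasurableSet K) {t : Set E}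
    (hK : K ⊆ ⋃ c ∈ t, Metric.ball c h) {η : ℝ≥0∞}
    (hη : ∀ c ∈ t, ‖⨍ y in Metric.ball c h, w y ∂μ‖ₑ ≤ η) :
    ∫⁻ x in K, ‖w x‖ₑ ^ p ∂μ ≤ 2 ^ (p - 1) *
      (ENNReal.ofReal (2 ^ Module.finrank ℝ E) * ENNReal.ofReal (2 * h) ^ p *
        ∫⁻ x, ‖fderiv ℝ w x‖ₑ ^ p ∂μ + η ^ p * μ K) := by
  have hp0 : 0 ≤ p := by linarith
  have hwc : Continuous w := hw.continuous
  have hb0 : μ (Metric.ball 0 h) ≠ 0 := (Metric.measure_ball_pos μ _ hh).ne'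
  have hb1 : μ (Metric.ball 0 h) ≠ ⊤ := measure_ball_lt_top.ne
  set I : E → ℝ≥0∞ := fun x => ∫⁻ z in Metric.ball 0 (2 * h), ‖w (x + z) - w x‖ₑ ^ p ∂μ with hI
  -- `w x` is an average over a ball of the cover minus the mean of `w y - w x`. That ball lies in
  -- the ball of radius `2 * h` about `x`, so the mean is controlled by `I x`, whose integral the
  -- translation estimate bounds.
  have hpt : ∀ x ∈ K, ‖w x‖ₑ ^ p ≤
      2 ^ (p - 1) * ((μ (Metric.ball 0 h))⁻¹ * I x + η ^ p) := by
    intro x hx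
    obtain ⟨c, hct, hxc⟩ := mem_iUnion₂.1 (hK hx)
    have hc0 : μ (Metric.ball c h) ≠ 0 := (Metric.measure_ball_pos μ _ hh).ne'
    have hc1 : μ (Metric.ball c h) ≠ ⊤ := measure_ball_lt_top.ne
    have hint : IntegrableOn w (Metric.ball c h) μ :=
      (hwc.continuousOn.integrableOn_compact (isCompact_closedBall c h)).mono_set
        Metric.ball_subset_closedBall
    have h1 : ⨍ y in Metric.ball c h, (w y - w x) ∂μ = ⨍ y in Metric.ball c h, w y ∂μ - w x := by
      rw [setAverage_eq, setAverage_eq, integral_sub hint (integrableOn_const hc1), smul_sub,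
        setIntegral_const, smul_smul, inv_mul_cancel₀
          (by rw [measureReal_def, ENNReal.toReal_ne_zero]; exact ⟨hc0, hc1⟩), one_smul]
    have h2 : ‖w x‖ₑ ≤ ‖⨍ y in Metric.ball c h, (w y - w x) ∂μ‖ₑ + η := by
      have : w x = -(⨍ y in Metric.ball c h, (w y - w x) ∂μ) + ⨍ y in Metric.ball c h, w y ∂μ := by
        rw [h1]; ring
      calc ‖w x‖ₑ = ‖-(⨍ y in Metric.ball c h, (w y - w x) ∂μ) +
              ⨍ y in Metric.ball c h, w y ∂μ‖ₑ := congrArg _ this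
        _ ≤ _ := enorm_add_le _ _
        _ ≤ _ := by rw [enorm_neg]; gcongr; exact hη c hct
    have h3 : ∫⁻ y in Metric.ball c h, ‖w y - w x‖ₑ ^ p ∂μ ≤ I x := by
      have hsub : Metric.ball c h ⊆ Metric.ball x (2 * h) := fun y hy => by
        rw [Metric.mem_ball] at *
        have := dist_triangle_right y x c
        linarith
      refine (lintegral_mono_set hsub).trans (le_of_eq ?_)
      simp only [hI]
      rw [← lintegral_indicator Metric.isOpen_ball.measurableSet,
        ← lintegral_indicator Metric.isOpen_ball.measurableSet,
        ← lintegral_add_left_eq_self _ x]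
      refine lintegral_congr fun z => ?_
      simp [indicator, Metric.mem_ball, dist_eq_norm]
    calc ‖w x‖ₑ ^ p ≤ (‖⨍ y in Metric.ball c h, (w y - w x) ∂μ‖ₑ + η) ^ p :=
          ENNReal.rpow_le_rpow h2 hp0
      _ ≤ 2 ^ (p - 1) * (‖⨍ y in Metric.ball c h, (w y - w x) ∂μ‖ₑ ^ p + η ^ p) :=
          ENNReal.rpow_add_le_mul_rpow_add_rpow _ _ hp
      _ ≤ _ := by
          gcongr
          refine (enorm_setAverage_rpow_le μ hc0 hc1 (by fun_prop) hp).trans ?_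
          rw [Measure.addHaar_ball_center]
          gcongr
  have hmeas : Measurable fun y : E × E => ‖w (y.1 + y.2) - w y.1‖ₑ ^ p := by
    have : Continuous fun y : E × E => ‖w (y.1 + y.2) - w y.1‖ₑ := by fun_prop
    exact this.measurable.pow_const p
  have hIm : Measurable I := hmeas.lintegral_prod_right'
  have hIint : ∫⁻ x, I x ∂μ ≤ μ (Metric.ball 0 (2 * h)) * (ENNReal.ofReal (2 * h) ^ p *
      ∫⁻ x, ‖fderiv ℝ w x‖ₑ ^ p ∂μ) := by
    rw [hI, lintegral_lintegral_swap hmeas.aemeasurable]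
    calc _ ≤ ∫⁻ z in Metric.ball 0 (2 * h), ENNReal.ofReal (2 * h) ^ p *
          ∫⁻ x, ‖fderiv ℝ w x‖ₑ ^ p ∂μ ∂μ := by
          refine setLIntegral_mono' Metric.isOpen_ball.measurableSet fun z hz => ?_
          refine (lintegral_enorm_translate_sub_rpow_le μ hw hp z).trans ?_
          gcongr
          rw [← ofReal_norm]
          exact ENNReal.ofReal_le_ofReal (by simpa using (mem_ball_zero_iff.1 hz).le)
      _ = _ := by rw [setLIntegral_const, mul_comm]
  calc _ ≤ ∫⁻ x in K, 2 ^ (p - 1) * ((μ (Metric.ball 0 h))⁻¹ * I x + η ^ p) ∂μ :=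
        setLIntegral_mono' hKm hpt
    _ = 2 ^ (p - 1) * ((μ (Metric.ball 0 h))⁻¹ * ∫⁻ x in K, I x ∂μ + η ^ p * μ K) := by
        rw [lintegral_const_mul _ (by fun_prop), lintegral_add_right _ (by fun_prop),
          lintegral_const_mul _ hIm, setLIntegral_const]
    _ ≤ 2 ^ (p - 1) * ((μ (Metric.ball 0 h))⁻¹ * (μ (Metric.ball 0 (2 * h)) *
          (ENNReal.ofReal (2 * h) ^ p * ∫⁻ x, ‖fderiv ℝ w x‖ₑ ^ p ∂μ)) + η ^ p * μ K) := by
        gcongr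
        exact (setLIntegral_le_lintegral _ _).trans hIint
    _ = _ := by
        -- The factor `2 ^ finrank` is the volume ratio of the balls of radii `2 * h` and `h`.
        rw [Measure.addHaar_ball_mul_of_pos μ 0 two_pos h]
        congr 2
        rw [← mul_assoc, ← mul_assoc, mul_comm (μ (Metric.ball 0 h))⁻¹, mul_assoc (ENNReal.ofReal _),
          ENNReal.mul_inv_cancel hb0 hb1, mul_one, mul_assoc]

/-- The Rellich–Kondrachov theorem for compactly supported functions. -/
theorem totallyBounded_of_gradient_bound {p : ℝ} (hp : 1 ≤ p)
    [Fact (1 ≤ ENNReal.ofReal p)] {K : Set E} (hK : IsCompact K)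
    {R : ℝ} {S : Set (Lp ℝ (ENNReal.ofReal p) (μ.restrict K))}
    (hS : ∀ f ∈ S, ∃ w : E → ℝ, ContDiff ℝ 1 w ∧ f =ᵐ[μ.restrict K] w ∧
      ∫⁻ x, ‖w x‖ₑ ^ p ∂μ ≤ ENNReal.ofReal R ∧
      ∫⁻ x, ‖fderiv ℝ w x‖ₑ ^ p ∂μ ≤ ENNReal.ofReal R) :
    TotallyBounded S := by
  have hp0 : 0 < p := by linarith
  have hKfin : μ K ≠ ⊤ := hK.measure_lt_top.ne
  -- `A * h ^ p` is the preceding estimate for the difference of two members of `S` whose averages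
  -- differ by at most `2 * h`; the inner `2 ^ (p - 1) * (R + R)` bounds the gradient of that
  -- difference.
  set A : ℝ≥0∞ := 2 ^ (p - 1) * (ENNReal.ofReal (2 ^ Module.finrank ℝ E) * 2 ^ p *
    (2 ^ (p - 1) * (ENNReal.ofReal R + ENNReal.ofReal R)) + 2 ^ p * μ K) with hA
  have hAfin : A ≠ ⊤ := by finiteness
  choose! w hw1 hwae hwR hwD using hS
  refine Metric.totallyBounded_of_finite_discretization fun ε hε => ?_
  obtain ⟨h, hh, hAh⟩ : ∃ h : ℝ, 0 < h ∧ A * ENNReal.ofReal h ^ p < ENNReal.ofReal ε ^ p := by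
    have ht : Tendsto (fun h : ℝ => A * ENNReal.ofReal h ^ p) (𝓝[>] 0) (𝓝 0) := by
      have h1 : Tendsto (fun h : ℝ => ENNReal.ofReal h ^ p) (𝓝[>] 0) (𝓝 0) := by
        have : Continuous fun h : ℝ => ENNReal.ofReal h ^ p :=
          ENNReal.continuous_rpow_const.comp ENNReal.continuous_ofReal
        have h2 := this.tendsto 0
        simp only [ENNReal.ofReal_zero, ENNReal.zero_rpow_of_pos hp0] at h2
        exact h2.mono_left nhdsWithin_le_nhds
      simpa using ENNReal.Tendsto.const_mul h1 (Or.inr hAfin)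
    have hpos : 0 < ENNReal.ofReal ε ^ p := ENNReal.rpow_pos (by simpa) ENNReal.ofReal_ne_top
    obtain ⟨h, h1, h2⟩ := ((ht.eventually (gt_mem_nhds hpos)).and self_mem_nhdsWithin).exists
    exact ⟨h, h2, h1⟩
  obtain ⟨t, -, htfin, hcov⟩ := hK.elim_finite_subcover_image (b := univ)
    (c := fun c : E => Metric.ball c h) (fun _ _ => Metric.isOpen_ball)
    (fun x _ => mem_iUnion₂.2 ⟨x, mem_univ _, Metric.mem_ball_self hh⟩)
  have := htfin.fintype
  -- The averages over the finite cover map `S` into a bounded set of a finite-dimensional space,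
  -- where finitely many `h`-balls suffice. Functions falling into the same `h`-ball are then
  -- `ε`-close in `L^p`.
  let a : S → (t → ℝ) := fun f c => ⨍ y in Metric.ball c.1 h, w f.1 y ∂μ
  have hb0 : μ (Metric.ball 0 h) ≠ 0 := (Metric.measure_ball_pos μ _ hh).ne'
  set B : ℝ≥0∞ := (μ (Metric.ball 0 h))⁻¹ * ENNReal.ofReal R with hB
  have hBfin : B ≠ ⊤ := ENNReal.mul_ne_top (by simpa using hb0) ENNReal.ofReal_ne_top
  have habd : range a ⊆ Metric.closedBall 0 (B ^ p⁻¹).toReal := by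
    rintro _ ⟨f, rfl⟩
    rw [mem_closedBall_zero_iff, pi_norm_le_iff_of_nonneg ENNReal.toReal_nonneg]
    intro c
    have h1 : ‖a f c‖ₑ ^ p ≤ B := by
      refine (enorm_setAverage_rpow_le μ (Metric.measure_ball_pos μ _ hh).ne'
        measure_ball_lt_top.ne (hw1 f.1 f.2).continuous hp).trans ?_
      rw [Measure.addHaar_ball_center]
      exact mul_le_mul_right ((setLIntegral_le_lintegral _ _).trans (hwR f.1 f.2)) _
    have h2 : ‖a f c‖ₑ ≤ B ^ p⁻¹ := by
      have := ENNReal.rpow_le_rpow h1 (by positivity : 0 ≤ p⁻¹)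
      rwa [ENNReal.rpow_rpow_inv hp0.ne'] at this
    have := ENNReal.toReal_mono (by finiteness) h2
    rwa [toReal_enorm] at this
  obtain ⟨s, hsfin, hs⟩ := Metric.totallyBounded_iff.1
    ((isCompact_closedBall _ _).totallyBounded.subset habd) h hh
  choose F hFs hF using fun f : S => mem_iUnion₂.1 (hs (mem_range_self f))
  refine ⟨s, hsfin.fintype, fun f => ⟨F f, hFs f⟩, fun f g hfg => ?_⟩
  have hfg' : F f = F g := congrArg Subtype.val hfg
  have hdist : dist (a f) (a g) ≤ 2 * h := by
    have h1 := hF f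
    have h2 := hF g
    rw [← hfg'] at h2
    rw [Metric.mem_ball] at h1 h2
    have := dist_triangle_right (a f) (a g) (F f)
    linarith
  set v : E → ℝ := fun x => w f.1 x - w g.1 x with hv
  have hf1 := hw1 f.1 f.2
  have hg1 := hw1 g.1 g.2
  have hvd : ContDiff ℝ 1 v := hf1.sub hg1
  have hD : ∫⁻ x, ‖fderiv ℝ v x‖ₑ ^ p ∂μ ≤
      2 ^ (p - 1) * (ENNReal.ofReal R + ENNReal.ofReal R) := by
    have hcf : Continuous (fderiv ℝ (w f.1)) := hf1.continuous_fderiv one_ne_zero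
    have hcg : Continuous (fderiv ℝ (w g.1)) := hg1.continuous_fderiv one_ne_zero
    calc _ ≤ ∫⁻ x, 2 ^ (p - 1) * (‖fderiv ℝ (w f.1) x‖ₑ ^ p + ‖fderiv ℝ (w g.1) x‖ₑ ^ p) ∂μ := by
          refine lintegral_mono fun x => ?_
          rw [hv, fderiv_fun_sub (hf1.differentiable one_ne_zero x)
            (hg1.differentiable one_ne_zero x)]
          exact (ENNReal.rpow_le_rpow enorm_sub_le hp0.le).trans
            (ENNReal.rpow_add_le_mul_rpow_add_rpow _ _ hp)
      _ = 2 ^ (p - 1) * (∫⁻ x, ‖fderiv ℝ (w f.1) x‖ₑ ^ p ∂μ +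
            ∫⁻ x, ‖fderiv ℝ (w g.1) x‖ₑ ^ p ∂μ) := by
          have h1 := hcf.enorm.measurable.pow_const p
          have h2 := hcg.enorm.measurable.pow_const p
          rw [lintegral_const_mul _ (by fun_prop), lintegral_add_left h1]
      _ ≤ _ := by gcongr; exacts [hwD f.1 f.2, hwD g.1 g.2]
  have havg : ∀ c ∈ t, ‖⨍ y in Metric.ball c h, v y ∂μ‖ₑ ≤ ENNReal.ofReal (2 * h) := by
    intro c hc
    have hint : ∀ f ∈ S, IntegrableOn (w f) (Metric.ball c h) μ := fun f hf =>
      ((hw1 f hf).continuous.continuousOn.integrableOn_compact (isCompact_closedBall c h)).mono_set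
        Metric.ball_subset_closedBall
    have h1 : ⨍ y in Metric.ball c h, v y ∂μ = a f ⟨c, hc⟩ - a g ⟨c, hc⟩ := by
      simp only [a, hv, setAverage_eq]
      rw [integral_sub (hint _ f.2) (hint _ g.2), smul_sub]
    rw [h1, ← ofReal_norm, ← dist_eq_norm]
    exact ENNReal.ofReal_le_ofReal ((dist_le_pi_dist _ _ _).trans hdist)
  have hmain := setLIntegral_enorm_rpow_le_of_average_le μ hvd hp hh hK.measurableSet hcov havg
  have hlt : ∫⁻ x in K, ‖v x‖ₑ ^ p ∂μ < ENNReal.ofReal ε ^ p := by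
    refine lt_of_le_of_lt (hmain.trans ?_) hAh
    rw [hA, ENNReal.ofReal_mul zero_le_two, ENNReal.ofReal_ofNat,
      ENNReal.mul_rpow_of_nonneg _ _ hp0.le]
    calc _ ≤ 2 ^ (p - 1) * (ENNReal.ofReal (2 ^ Module.finrank ℝ E) *
          (2 ^ p * ENNReal.ofReal h ^ p) * (2 ^ (p - 1) * (ENNReal.ofReal R + ENNReal.ofReal R)) +
            2 ^ p * ENNReal.ofReal h ^ p * μ K) := by gcongr
      _ = _ := by ring
  have hae : (f.1 - g.1 : Lp ℝ (ENNReal.ofReal p) (μ.restrict K)) =ᵐ[μ.restrict K] v := by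
    filter_upwards [Lp.coeFn_sub f.1 g.1, hwae f.1 f.2, hwae g.1 g.2] with x h1 h2 h3
    rw [h1, Pi.sub_apply, h2, h3]
  change dist f.1 g.1 < ε
  rw [dist_eq_norm, Lp.norm_def, eLpNorm_congr_ae hae,
    eLpNorm_eq_lintegral_rpow_enorm_toReal (by simpa using hp0) ENNReal.ofReal_ne_top,
    ENNReal.toReal_ofReal hp0.le]
  refine ENNReal.toReal_lt_of_lt_ofReal ?_
  have := ENNReal.rpow_lt_rpow hlt (by positivity : 0 < 1 / p)
  rwa [one_div, ENNReal.rpow_rpow_inv hp0.ne', ← one_div] at this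

end Compactness

/-! ### `W_0^{1,p}` as a closed subspace, and integration by parts -/

section SobolevSpace

abbrev Euc (d : ℕ) := EuclideanSpace ℝ (Fin d)

/-- `L^p(M)`. -/
abbrev LpScalar {d : ℕ} (p : ℝ) (M : Set (Euc d)) :=
  Lp ℝ (ENNReal.ofReal p) ((volume : Measure (Euc d)).restrict M)

/-- `L^p(M, ℝ^d)`. -/
abbrev LpVector {d : ℕ} (p : ℝ) (M : Set (Euc d)) :=
  Lp (Euc d) (ENNReal.ofReal p) ((volume : Measure (Euc d)).restrict M)

variable {d : ℕ} {p : ℝ} {M : Set (Euc d)}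

theorem gradient_fun_add' {f g : Euc d → ℝ} {x : Euc d} (hf : DifferentiableAt ℝ f x)
    (hg : DifferentiableAt ℝ g x) : ∇ (fun y => f y + g y) x = ∇ f x + ∇ g x := by
  simp [gradient, fderiv_fun_add hf hg]

theorem gradient_fun_const_mul' {f : Euc d → ℝ} {x : Euc d} (c : ℝ)
    (hf : DifferentiableAt ℝ f x) : ∇ (fun y => c * f y) x = c • ∇ f x := by
  simp [gradient, fderiv_const_mul hf]

theorem norm_gradient (f : Euc d → ℝ) (x : Euc d) : ‖∇ f x‖ = ‖fderiv ℝ f x‖ := by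
  simp [gradient]

theorem continuous_gradient {f : Euc d → ℝ} (hf : ContDiff ℝ 1 f) : Continuous (∇ f) :=
  (InnerProductSpace.toDual ℝ (Euc d)).symm.continuous.comp (hf.continuous_fderiv one_ne_zero)

theorem hasCompactSupport_gradient {f : Euc d → ℝ} (hf : HasCompactSupport f) :
    HasCompactSupport (∇ f) :=
  (hf.fderiv ℝ).comp_left (map_zero _)

theorem isTestFunction_zero (Ω : Set (Euc d)) : IsTestFunction Ω fun _ => (0 : ℝ) :=
  ⟨contDiff_const, HasCompactSupport.zero, by
    rw [show tsupport (fun _ : Euc d => (0 : ℝ)) = ∅ from tsupport_eq_empty_iff.2 rfl]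
    exact empty_subset _⟩

theorem IsTestFunction.add {Ω : Set (Euc d)} {φ ψ : Euc d → ℝ} (hφ : IsTestFunction Ω φ)
    (hψ : IsTestFunction Ω ψ) : IsTestFunction Ω fun x => φ x + ψ x :=
  ⟨hφ.contDiff.add hψ.contDiff, hφ.hasCompactSupport.add hψ.hasCompactSupport,
    (tsupport_add φ ψ).trans (union_subset hφ.tsupport_subset hψ.tsupport_subset)⟩

theorem IsTestFunction.const_mul {Ω : Set (Euc d)} {φ : Euc d → ℝ} (hφ : IsTestFunction Ω φ)
    (c : ℝ) : IsTestFunction Ω fun x => c * φ x :=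
  ⟨contDiff_const.mul hφ.contDiff, hφ.hasCompactSupport.mul_left,
    (tsupport_mul_subset_right (f := fun _ => c) (g := φ)).trans hφ.tsupport_subset⟩

theorem IsTestFunction.contDiff_one {Ω : Set (Euc d)} {φ : Euc d → ℝ} (hφ : IsTestFunction Ω φ) :
    ContDiff ℝ 1 φ := hφ.contDiff.of_le (by exact_mod_cast le_top)

variable [Fact (1 ≤ ENNReal.ofReal p)]

variable (p M) in
/-- The pairs `(φ, ∇φ)` with `φ ∈ C_c^∞(int M)`, as elements of `L^p`. -/
def testPairs : Submodule ℝ (LpScalar p M × LpVector p M) where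
  carrier := {w | ∃ φ, IsTestFunction (interior M) φ ∧ w.1 =ᵐ[volume.restrict M] φ ∧
    w.2 =ᵐ[volume.restrict M] ∇ φ}
  zero_mem' := ⟨_, isTestFunction_zero _, Lp.coeFn_zero _ _ _, by
    rw [gradient_fun_const']; exact Lp.coeFn_zero _ _ _⟩
  add_mem' := by
    rintro a b ⟨φ, hφ, h1, h2⟩ ⟨ψ, hψ, h3, h4⟩
    refine ⟨_, hφ.add hψ, ?_, ?_⟩
    · filter_upwards [Lp.coeFn_add a.1 b.1, h1, h3] with x h5 h6 h7
      rw [Prod.fst_add, h5, Pi.add_apply, h6, h7]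
    · filter_upwards [Lp.coeFn_add a.2 b.2, h2, h4] with x h5 h6 h7
      rw [Prod.snd_add, h5, Pi.add_apply, h6, h7, gradient_fun_add'
        (hφ.contDiff_one.differentiable one_ne_zero x)
        (hψ.contDiff_one.differentiable one_ne_zero x)]
  smul_mem' := by
    rintro c a ⟨φ, hφ, h1, h2⟩
    refine ⟨_, hφ.const_mul c, ?_, ?_⟩
    · filter_upwards [Lp.coeFn_smul c a.1, h1] with x h5 h6
      rw [Prod.smul_fst, h5, Pi.smul_apply, h6, smul_eq_mul]
    · filter_upwards [Lp.coeFn_smul c a.2, h2] with x h5 h6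
      rw [Prod.smul_snd, h5, Pi.smul_apply, h6, gradient_fun_const_mul' c
        (hφ.contDiff_one.differentiable one_ne_zero x)]

variable (p M) in
/-- The pairs `(u, ∇u)` with `u ∈ W_0^{1,p}(M)`, as elements of `L^p`. -/
def sobolevZero : Submodule ℝ (LpScalar p M × LpVector p M) := (testPairs p M).topologicalClosure

theorem isClosed_sobolevZero : IsClosed (sobolevZero p M : Set (LpScalar p M × LpVector p M)) :=
  Submodule.isClosed_topologicalClosure _

/-- This links the closure in the product of `L^p` spaces to the approximating sequences in the
definition of `MemW0`. -/
theorem mem_sobolevZero_iff {w : LpScalar p M × LpVector p M} :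
    w ∈ sobolevZero p M ↔ ∃ φ : ℕ → Euc d → ℝ, (∀ n, IsTestFunction (interior M) (φ n)) ∧
      Tendsto (fun n => eLpNorm (fun x => w.1 x - φ n x) (ENNReal.ofReal p) (volume.restrict M))
        atTop (𝓝 0) ∧
      Tendsto (fun n => eLpNorm (fun x => w.2 x - ∇ (φ n) x) (ENNReal.ofReal p)
        (volume.restrict M)) atTop (𝓝 0) := by
  have hnorm : ∀ {F : Type} [NormedAddCommGroup F] (a : Lp F (ENNReal.ofReal p)
      ((volume : Measure (Euc d)).restrict M)) (s : ℕ → Lp F (ENNReal.ofReal p)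
      ((volume : Measure (Euc d)).restrict M)) (f : ℕ → Euc d → F),
      (∀ n, s n =ᵐ[volume.restrict M] f n) → (Tendsto s atTop (𝓝 a) ↔
      Tendsto (fun n => eLpNorm (fun x => a x - f n x) (ENNReal.ofReal p) (volume.restrict M))
        atTop (𝓝 0)) := by
    intro F _ a s f h
    rw [Lp.tendsto_Lp_iff_tendsto_eLpNorm']
    refine tendsto_congr fun n => ?_
    rw [eLpNorm_sub_comm]
    refine eLpNorm_congr_ae ?_
    filter_upwards [h n] with x hx
    rw [Pi.sub_apply, hx]
  constructor
  · intro hw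
    obtain ⟨s, hs, hlim⟩ := mem_closure_iff_seq_limit.1 hw
    choose φ hφ h1 h2 using hs
    exact ⟨φ, hφ, (hnorm w.1 (fun n => (s n).1) φ h1).1 (((Prod.tendsto_iff s w).1 hlim).1),
      (hnorm w.2 (fun n => (s n).2) (fun n => ∇ (φ n)) h2).1 (((Prod.tendsto_iff s w).1 hlim).2)⟩
  · rintro ⟨φ, hφ, h1, h2⟩
    have m1 : ∀ n, MemLp (φ n) (ENNReal.ofReal p) (volume.restrict M) := fun n =>
      ((hφ n).contDiff.continuous.memLp_of_hasCompactSupport (hφ n).hasCompactSupport).restrict M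
    have m2 : ∀ n, MemLp (∇ (φ n)) (ENNReal.ofReal p) (volume.restrict M) := fun n =>
      ((continuous_gradient (hφ n).contDiff_one).memLp_of_hasCompactSupport
        (hasCompactSupport_gradient (hφ n).hasCompactSupport)).restrict M
    refine mem_closure_iff_seq_limit.2 ⟨fun n => ((m1 n).toLp _, (m2 n).toLp _),
      fun n => ⟨φ n, hφ n, (m1 n).coeFn_toLp, (m2 n).coeFn_toLp⟩, ?_⟩
    rw [Prod.tendsto_iff]
    exact ⟨(hnorm w.1 _ φ fun n => (m1 n).coeFn_toLp).2 h1,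
      (hnorm w.2 _ (fun n => ∇ (φ n)) fun n => (m2 n).coeFn_toLp).2 h2⟩

omit [Fact (1 ≤ ENNReal.ofReal p)] in
-- The fundamental lemma of the calculus of variations, applied to `g - g'`. It makes the chosen
-- `weakGradient` comparable with any other candidate.
theorem HasWeakGradient.ae_eq {Ω : Set (Euc d)} (hΩ : IsOpen Ω) {u : Euc d → ℝ}
    {g g' : Euc d → Euc d} (h : HasWeakGradient Ω u g) (h' : HasWeakGradient Ω u g') :
    g =ᵐ[volume.restrict Ω] g' := by
  have hz := hΩ.ae_eq_zero_of_integral_contDiff_smul_eq_zero (μ := volume) (f := g - g')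
    (h.locallyIntegrableOn_grad.sub h'.locallyIntegrableOn_grad) (by
      intro φ h1 h2 h3
      have hφ : IsTestFunction Ω φ := ⟨h1, h2, h3⟩
      have e : ∫ x in Ω, φ x • g x = ∫ x in Ω, φ x • g' x :=
        neg_injective ((h.integral_eq φ hφ).symm.trans (h'.integral_eq φ hφ))
      have hint : ∀ k : Euc d → Euc d, LocallyIntegrableOn k Ω volume →
          IntegrableOn (fun x => φ x • k x) Ω volume := by
        intro k hk
        have : IntegrableOn (fun x => φ x • k x) (tsupport φ) volume :=
          (hk.integrableOn_compact_subset h3 h2).continuousOn_smul h1.continuous.continuousOn h2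
        refine Integrable.integrableOn ?_
        refine (integrableOn_iff_integrable_of_support_subset ?_).1 this
        exact (Function.support_smul_subset_left φ k).trans (subset_tsupport φ)
      rw [← setIntegral_eq_integral_of_forall_compl_eq_zero (s := Ω)]
      · simp only [Pi.sub_apply, smul_sub]
        rw [integral_sub (hint g h.locallyIntegrableOn_grad) (hint g' h'.locallyIntegrableOn_grad),
          e, sub_self]
      · intro x hx
        rw [image_eq_zero_of_notMem_tsupport fun hx' => hx (h3 hx'), zero_smul])
  rw [Filter.EventuallyEq, ae_restrict_iff' hΩ.measurableSet]
  filter_upwards [hz] with x hx hxΩ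
  exact sub_eq_zero.1 (hx hxΩ)

theorem integral_smul_gradient_eq {f ψ : Euc d → ℝ} (hf : ContDiff ℝ 1 f) (hψ : ContDiff ℝ 1 ψ)
    (hfs : HasCompactSupport f) (hψs : HasCompactSupport ψ) :
    ∫ x, f x • ∇ ψ x = - ∫ x, ψ x • ∇ f x := by
  have hi : ∀ {a b : Euc d → ℝ}, ContDiff ℝ 1 a → ContDiff ℝ 1 b → HasCompactSupport a →
      Integrable (fun x => a x • ∇ b x) := fun ha hb has =>
    (ha.continuous.smul (continuous_gradient hb)).integrable_of_hasCompactSupport has.smul_right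
  refine ext_inner_left ℝ fun v => ?_
  rw [inner_neg_right, ← integral_inner (hi hf hψ hfs), ← integral_inner (hi hψ hf hψs)]
  have e : ∀ (a b : Euc d → ℝ) x, inner ℝ v (a x • ∇ b x) = a x * fderiv ℝ b x v := fun a b x => by
    rw [inner_smul_right, inner_gradient_right]; rfl
  simp only [e]
  have hi' : ∀ {a b : Euc d → ℝ}, ContDiff ℝ 1 a → ContDiff ℝ 1 b → HasCompactSupport a →
      Integrable (fun x => a x * fderiv ℝ b x v) := fun {a b} ha hb has =>
    ((hi ha hb has).const_inner v).congr (ae_of_all _ (e a b))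
  rw [integral_mul_fderiv_eq_neg_fderiv_mul_of_integrable]
  · simp only [mul_comm]
  · exact (hi' hψ hf hψs).congr (ae_of_all _ fun x => mul_comm _ _)
  · exact hi' hf hψ hfs
  · exact (hf.continuous.mul hψ.continuous).integrable_of_hasCompactSupport hfs.mul_right
  · exact fun x _ => hf.differentiable one_ne_zero x
  · exact fun x _ => hψ.differentiable one_ne_zero x

end SobolevSpace

/-! ### Weak gradients, Poincaré, Rellich–Kondrachov and mollification -/

section SobolevZero

variable {d : ℕ} {p : ℝ} {M : Set (Euc d)}

/-- On a finite measure space a bounded `k` lies in the conjugate Lebesgue space, so this is a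
Hölder pairing with a fixed element. -/
theorem continuous_integral_smul_of_bounded {α F : Type*} [MeasurableSpace α] {μ : Measure α}
    [IsFiniteMeasure μ] [NormedAddCommGroup F] [NormedSpace ℝ F] [CompleteSpace F]
    {q : ℝ≥0∞} [Fact (1 ≤ q)] {k : α → F} {C : ℝ} (hk : AEStronglyMeasurable k μ)
    (hC : ∀ x, ‖k x‖ ≤ C) : Continuous fun f : Lp ℝ q μ => ∫ x, f x • k x ∂μ := by
  have : ENNReal.HolderConjugate q (1 - q⁻¹)⁻¹ :=
    ENNReal.HolderConjugate.inv_one_sub_inv' Fact.out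
  have : Fact (1 ≤ (1 - q⁻¹)⁻¹) := ⟨by simp⟩
  have hm : MemLp k (1 - q⁻¹)⁻¹ μ := MemLp.of_bound hk C (ae_of_all _ hC)
  have h := (((ContinuousLinearMap.lsmul ℝ ℝ (E := F)).lpPairing μ q (1 - q⁻¹)⁻¹).flip
    (hm.toLp k)).continuous
  refine h.congr fun f => ?_
  rw [ContinuousLinearMap.flip_apply, ContinuousLinearMap.lpPairing_eq_integral]
  refine integral_congr_ae ?_
  filter_upwards [hm.coeFn_toLp] with x hx
  simp [hx]

theorem continuous_integral_bounded_smul {α F : Type*} [MeasurableSpace α] {μ : Measure α}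
    [IsFiniteMeasure μ] [NormedAddCommGroup F] [NormedSpace ℝ F] [CompleteSpace F]
    {q : ℝ≥0∞} [Fact (1 ≤ q)] {k : α → ℝ} {C : ℝ} (hk : AEStronglyMeasurable k μ)
    (hC : ∀ x, ‖k x‖ ≤ C) : Continuous fun f : Lp F q μ => ∫ x, k x • f x ∂μ := by
  have : ENNReal.HolderConjugate q (1 - q⁻¹)⁻¹ :=
    ENNReal.HolderConjugate.inv_one_sub_inv' Fact.out
  have : Fact (1 ≤ (1 - q⁻¹)⁻¹) := ⟨by simp⟩
  have hm : MemLp k (1 - q⁻¹)⁻¹ μ := MemLp.of_bound hk C (ae_of_all _ hC)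
  have h := (((ContinuousLinearMap.lsmul ℝ ℝ (E := F)).flip.lpPairing μ q (1 - q⁻¹)⁻¹).flip
    (hm.toLp k)).continuous
  refine h.congr fun f => ?_
  rw [ContinuousLinearMap.flip_apply, ContinuousLinearMap.lpPairing_eq_integral]
  refine integral_congr_ae ?_
  filter_upwards [hm.coeFn_toLp] with x hx
  simp [hx]

theorem setIntegral_eq_integral_of_tsupport_subset {F : Type*} [NormedAddCommGroup F]
    [NormedSpace ℝ F] {s : Set (Euc d)} {φ : Euc d → ℝ} (hφ : tsupport φ ⊆ s) (k : Euc d → F) :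
    ∫ x in s, φ x • k x = ∫ x, φ x • k x :=
  setIntegral_eq_integral_of_forall_compl_eq_zero fun x hx => by
    rw [image_eq_zero_of_notMem_tsupport fun hx' => hx (hφ hx'), zero_smul]

variable [Fact (1 ≤ ENNReal.ofReal p)]

/-- Integration by parts holds for test pairs, and both sides are continuous in `L^p`, so it passes
to the closure. The null frontier allows integrals over `M` and over its interior to be exchanged.
-/
theorem hasWeakGradient_of_mem_sobolevZero (hM : IsCompact M) (hfr : volume (frontier M) = 0)
    {w : LpScalar p M × LpVector p M} (hw : w ∈ sobolevZero p M) {u : Euc d → ℝ}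
    {g : Euc d → Euc d} (hu : w.1 =ᵐ[volume.restrict M] u) (hg : w.2 =ᵐ[volume.restrict M] g) :
    HasWeakGradient (interior M) u g := by
  have : IsFiniteMeasure ((volume : Measure (Euc d)).restrict M) :=
    isFiniteMeasure_restrict.2 hM.measure_lt_top.ne
  have hμ : (volume : Measure (Euc d)).restrict (interior M) = volume.restrict M :=
    Measure.restrict_congr_set (interior_ae_eq_of_null_frontier hfr)
  have h1 : Integrable u (volume.restrict M) :=
    ((Lp.memLp w.1).integrable Fact.out).congr hu
  have h2 : Integrable g (volume.restrict M) :=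
    ((Lp.memLp w.2).integrable Fact.out).congr hg
  refine ⟨?_, ?_, fun φ hφ => ?_⟩
  · exact IntegrableOn.locallyIntegrableOn (by rw [IntegrableOn, hμ]; exact h1)
  · exact IntegrableOn.locallyIntegrableOn (by rw [IntegrableOn, hμ]; exact h2)
  have hφ1 := hφ.contDiff_one
  obtain ⟨C, hC⟩ := hφ.hasCompactSupport.exists_bound_of_continuous hφ1.continuous
  obtain ⟨C', hC'⟩ := (hasCompactSupport_gradient hφ.hasCompactSupport).exists_bound_of_continuous
    (continuous_gradient hφ1)
  have hclosed : IsClosed {w : LpScalar p M × LpVector p M |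
      ∫ x in M, w.1 x • ∇ φ x = - ∫ x in M, φ x • w.2 x} :=
    isClosed_eq ((continuous_integral_smul_of_bounded
      (continuous_gradient hφ1).aestronglyMeasurable hC').comp continuous_fst)
      (((continuous_integral_bounded_smul hφ1.continuous.aestronglyMeasurable hC).comp
        continuous_snd).neg)
  have hsub : (testPairs p M : Set (LpScalar p M × LpVector p M)) ⊆
      {w | ∫ x in M, w.1 x • ∇ φ x = - ∫ x in M, φ x • w.2 x} := by
    rintro v ⟨ψ, hψ, e1, e2⟩
    have e3 : ∫ x in M, v.1 x • ∇ φ x = ∫ x in M, ψ x • ∇ φ x :=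
      integral_congr_ae (e1.mono fun x hx => by simp only [hx])
    have e4 : ∫ x in M, φ x • v.2 x = ∫ x in M, φ x • ∇ ψ x :=
      integral_congr_ae (e2.mono fun x hx => by simp only [hx])
    rw [mem_ofPred_eq, e3, e4,
      setIntegral_eq_integral_of_tsupport_subset (hψ.tsupport_subset.trans interior_subset),
      setIntegral_eq_integral_of_tsupport_subset (hφ.tsupport_subset.trans interior_subset),
      integral_smul_gradient_eq hψ.contDiff_one hφ1 hψ.hasCompactSupport hφ.hasCompactSupport]
  have hmem : ∫ x in M, w.1 x • ∇ φ x = - ∫ x in M, φ x • w.2 x :=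
    closure_minimal hsub hclosed hw
  rw [hμ, ← integral_congr_ae (hu.mono fun x hx => by simp only [hx] :
      (fun x => w.1 x • ∇ φ x) =ᵐ[volume.restrict M] fun x => u x • ∇ φ x), hmem,
    integral_congr_ae (hg.mono fun x hx => by simp only [hx] :
      (fun x => φ x • w.2 x) =ᵐ[volume.restrict M] fun x => φ x • g x)]

/-- The elements of `sobolevZero p M` are the classes of the functions in `W_0^{1,p}(M)`. -/
theorem memW0_of_mem_sobolevZero (hM : IsCompact M) (hfr : volume (frontier M) = 0)
    {w : LpScalar p M × LpVector p M} (hw : w ∈ sobolevZero p M) {u : Euc d → ℝ}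
    (hu : w.1 =ᵐ[volume.restrict M] u) :
    MemW0 p M u ∧ weakGradient M u =ᵐ[volume.restrict M] w.2 := by
  have hμ : (volume : Measure (Euc d)).restrict (interior M) = volume.restrict M :=
    Measure.restrict_congr_set (interior_ae_eq_of_null_frontier hfr)
  have hwg := hasWeakGradient_of_mem_sobolevZero hM hfr hw hu ae_eq_rfl
  have hex : ∃ g, HasWeakGradient (interior M) u g := ⟨_, hwg⟩
  have hspec : HasWeakGradient (interior M) u (weakGradient M u) := by
    rw [weakGradient, dif_pos hex]; exact hex.choose_spec
  have hae : weakGradient M u =ᵐ[volume.restrict M] w.2 := by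
    have := hspec.ae_eq isOpen_interior hwg
    simpa only [hμ] using this
  obtain ⟨φ, hφ, h1, h2⟩ := mem_sobolevZero_iff.1 hw
  refine ⟨⟨⟨(memLp_congr_ae hu).1 (Lp.memLp w.1), hex,
    (memLp_congr_ae hae).2 (Lp.memLp w.2)⟩, φ, hφ, ?_, ?_⟩, hae⟩
  · refine h1.congr fun n => eLpNorm_congr_ae (hu.mono fun x hx => by simp only [hx])
  · refine h2.congr fun n => eLpNorm_congr_ae (hae.mono fun x hx => by simp only [hx])

theorem MemW0.exists_mem_sobolevZero {u : Euc d → ℝ} (hu : MemW0 p M u) :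
    ∃ w ∈ sobolevZero p M, w.1 =ᵐ[volume.restrict M] u ∧
      w.2 =ᵐ[volume.restrict M] weakGradient M u := by
  obtain ⟨φ, hφ, h1, h2⟩ := hu.exists_approx
  have e1 := hu.memW.memLp.coeFn_toLp
  have e2 := hu.memW.memLp_weakGradient.coeFn_toLp
  refine ⟨(hu.memW.memLp.toLp u, hu.memW.memLp_weakGradient.toLp _),
    mem_sobolevZero_iff.2 ⟨φ, hφ, ?_, ?_⟩, e1, e2⟩
  · refine h1.congr fun n => eLpNorm_congr_ae (e1.mono fun x hx => by simp only [hx])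
  · refine h2.congr fun n => eLpNorm_congr_ae (e2.mono fun x hx => by simp only [hx])

theorem enorm_lp_eq_eLpNorm_of_support_subset {F : Type*} [NormedAddCommGroup F]
    {k : Euc d → F} (hk : ∀ x ∉ M, k x = 0)
    {f : Lp F (ENNReal.ofReal p) ((volume : Measure (Euc d)).restrict M)}
    (hf : f =ᵐ[volume.restrict M] k) : ‖f‖ₑ = eLpNorm k (ENNReal.ofReal p) volume := by
  rw [Lp.enorm_def, eLpNorm_congr_ae hf, eLpNorm_restrict_eq_of_support_subset]
  exact Function.support_subset_iff'.2 hk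

theorem lintegral_enorm_rpow_eq_of_support_subset {F : Type*} [NormedAddCommGroup F] (hp : 0 < p)
    {k : Euc d → F} (hk : ∀ x ∉ M, k x = 0)
    {f : Lp F (ENNReal.ofReal p) ((volume : Measure (Euc d)).restrict M)}
    (hf : f =ᵐ[volume.restrict M] k) :
    ∫⁻ x, ‖k x‖ₑ ^ p = ENNReal.ofReal (‖f‖ ^ p) := by
  rw [← ENNReal.ofReal_rpow_of_nonneg (norm_nonneg _) hp.le, ofReal_norm,
    enorm_lp_eq_eLpNorm_of_support_subset hk hf,
    eLpNorm_eq_lintegral_rpow_enorm_toReal (by simpa using hp) ENNReal.ofReal_ne_top,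
    ENNReal.toReal_ofReal hp.le, one_div, ENNReal.rpow_inv_rpow hp.ne']

omit [Fact (1 ≤ ENNReal.ofReal p)] in
theorem IsTestFunction.eq_zero_of_notMem {φ : Euc d → ℝ} (hφ : IsTestFunction (interior M) φ)
    {x : Euc d} (hx : x ∉ M) : φ x = 0 :=
  image_eq_zero_of_notMem_tsupport fun h => hx (interior_subset (hφ.tsupport_subset h))

omit [Fact (1 ≤ ENNReal.ofReal p)] in
theorem IsTestFunction.gradient_eq_zero_of_notMem {φ : Euc d → ℝ}
    (hφ : IsTestFunction (interior M) φ) {x : Euc d} (hx : x ∉ M) : ∇ φ x = 0 := by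
  have : fderiv ℝ φ x = 0 := by
    by_contra h
    exact hx (interior_subset (hφ.tsupport_subset (support_fderiv_subset ℝ h)))
  simp [gradient, this]

/-- Poincaré's inequality. -/
theorem exists_norm_le_of_mem_sobolevZero (hp : 1 < p) (hpd : p < d) (hM : IsCompact M) :
    ∃ C : ℝ, 0 < C ∧ ∀ w ∈ sobolevZero p M, ‖w.1‖ ≤ C * ‖w.2‖ := by
  set K := eLpNormLESNormFDerivOfLeConst ℝ (volume : Measure (Euc d)) M p.toNNReal p.toNNReal
  have hp0 : 0 < p := by linarith
  have htest : ∀ w ∈ testPairs p M, ‖w.1‖ ≤ (K + 1) * ‖w.2‖ := by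
    rintro w ⟨φ, hφ, h1, h2⟩
    -- The Gagliardo–Nirenberg–Sobolev inequality on a bounded set with both exponents equal to `p`;
    -- this is where `p < d` enters.
    have h := eLpNorm_le_eLpNorm_fderiv_of_le (volume : Measure (Euc d)) (s := M)
      hφ.contDiff_one (Function.support_subset_iff'.2 fun x => hφ.eq_zero_of_notMem)
      (p := p.toNNReal) (q := p.toNNReal) (by simpa using hp.le)
      (by
        rw [finrank_euclideanSpace_fin]
        exact (Real.toNNReal_lt_iff_lt_coe hp0.le).2 (by simpa using hpd))
      (by simp) hM.isBounded
    have e2 : eLpNorm (fderiv ℝ φ) (ENNReal.ofReal p) volume = ‖w.2‖ₑ := by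
      rw [enorm_lp_eq_eLpNorm_of_support_subset
        (fun x hx => hφ.gradient_eq_zero_of_notMem hx) h2]
      exact eLpNorm_congr_norm_ae (ae_of_all _ fun x => (norm_gradient φ x).symm)
    have h' : ‖w.1‖ₑ ≤ K * ‖w.2‖ₑ := by
      rw [enorm_lp_eq_eLpNorm_of_support_subset
        (fun x hx => hφ.eq_zero_of_notMem hx) h1, ← e2]
      exact h
    have h3 := ENNReal.toReal_mono (by finiteness) h'
    rw [ENNReal.toReal_mul, toReal_enorm, toReal_enorm, ENNReal.coe_toReal] at h3
    nlinarith [norm_nonneg w.2]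
  refine ⟨K + 1, by positivity, fun w hw => ?_⟩
  have hclosed : IsClosed {w : LpScalar p M × LpVector p M | ‖w.1‖ ≤ (K + 1) * ‖w.2‖} :=
    isClosed_le (by fun_prop) (by fun_prop)
  exact closure_minimal htest hclosed hw

/-- The Rellich–Kondrachov theorem: the embedding of `W_0^{1,p}(M)` into `L^p(M)` is compact. -/
theorem totallyBounded_of_mem_sobolevZero (hp : 1 < p) (hpd : p < d) (hM : IsCompact M) (R : ℝ) :
    TotallyBounded {x : LpScalar p M | ∃ w ∈ sobolevZero p M, w.1 = x ∧ ‖w.2‖ ≤ R} := by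
  have hp0 : 0 < p := by linarith
  obtain ⟨C, hC, hPoinc⟩ := exists_norm_le_of_mem_sobolevZero hp hpd hM
  -- The slack `R + 1` ensures that an element with gradient norm at most `R` is a limit of test
  -- pairs obeying the bound, so it lies in the closure of `S`.
  set S : Set (LpScalar p M) := {x | ∃ w ∈ testPairs p M, w.1 = x ∧ ‖w.2‖ ≤ R + 1}
  have hS : TotallyBounded S := by
    refine totallyBounded_of_gradient_bound volume hp.le hM
      (R := max ((C * (R + 1)) ^ p) ((R + 1) ^ p)) ?_
    rintro _ ⟨w, hw, rfl, hwR⟩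
    have h3 := hPoinc w (subset_closure hw)
    obtain ⟨φ, hφ, h1, h2⟩ := hw
    refine ⟨φ, hφ.contDiff_one, h1, ?_, ?_⟩
    · rw [lintegral_enorm_rpow_eq_of_support_subset hp0
        (fun x hx => hφ.eq_zero_of_notMem hx) h1]
      refine ENNReal.ofReal_le_ofReal (le_max_of_le_left ?_)
      exact Real.rpow_le_rpow (norm_nonneg _)
        (h3.trans (mul_le_mul_of_nonneg_left hwR hC.le)) hp0.le
    · have e : ∀ x, ‖fderiv ℝ φ x‖ₑ = ‖∇ φ x‖ₑ := fun x => by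
        rw [← ofReal_norm, ← ofReal_norm, norm_gradient]
      simp only [e]
      rw [lintegral_enorm_rpow_eq_of_support_subset hp0
        (fun x hx => hφ.gradient_eq_zero_of_notMem hx) h2]
      exact ENNReal.ofReal_le_ofReal (le_max_of_le_right
        (Real.rpow_le_rpow (norm_nonneg _) hwR hp0.le))
  refine hS.closure.subset ?_
  rintro _ ⟨w, hw, rfl, hwR⟩
  obtain ⟨s, hs, hlim⟩ := mem_closure_iff_seq_limit.1 hw
  have hlim' := (Prod.tendsto_iff s w).1 hlim
  refine mem_closure_of_tendsto hlim'.1 ?_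
  filter_upwards [hlim'.2.norm.eventually (gt_mem_nhds (by linarith : ‖w.2‖ < R + 1))] with n hn
  exact ⟨s n, hs n, rfl, hn.le⟩

/-- Uniform approximation of a `C^1` function with compact support by test functions. -/
theorem exists_isTestFunction_near {Ω : Set (Euc d)} (hΩ : IsOpen Ω) {f : Euc d → ℝ}
    (hf : ContDiff ℝ 1 f) (hfs : HasCompactSupport f) (hfΩ : tsupport f ⊆ Ω) {ε : ℝ}
    (hε : 0 < ε) :
    ∃ φ, IsTestFunction Ω φ ∧ ∀ x, ‖f x - φ x‖ ≤ ε ∧ ‖∇ f x - ∇ φ x‖ ≤ ε := by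
  have hf' : Continuous (fderiv ℝ f) := hf.continuous_fderiv one_ne_zero
  obtain ⟨δ₁, hδ₁, h₁⟩ := Metric.uniformContinuous_iff.1
    (hfs.uniformContinuous_of_continuous hf.continuous) ε hε
  obtain ⟨δ₂, hδ₂, h₂⟩ := Metric.uniformContinuous_iff.1
    ((hfs.fderiv ℝ).uniformContinuous_of_continuous hf') ε hε
  obtain ⟨δ₃, hδ₃, h₃⟩ := IsCompact.exists_cthickening_subset_open hfs hΩ hfΩ
  -- The mollification radius respects the moduli of continuity of `f` and of its derivative, and
  -- keeps the support inside `Ω`.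
  set r := min (min δ₁ δ₂) δ₃ with hr
  have hr0 : 0 < r := by positivity
  let ρ : ContDiffBump (0 : Euc d) := ⟨r / 2, r, by positivity, by linarith⟩
  let φ : Euc d → ℝ := convolution (ρ.normed volume) f (ContinuousLinearMap.lsmul ℝ ℝ) volume
  have hsupp : tsupport φ ⊆ Metric.cthickening r (tsupport f) := by
    refine closure_minimal ?_ Metric.isClosed_cthickening
    refine (support_convolution_subset _).trans ?_
    rw [ρ.support_normed_eq]
    rintro _ ⟨a, ha, b, hb, rfl⟩
    refine Metric.mem_cthickening_of_dist_le _ b _ _ (subset_tsupport f hb) ?_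
    simpa using (mem_ball_zero_iff.1 ha).le
  refine ⟨φ, ⟨ρ.hasCompactSupport_normed.contDiff_convolution_left _ ρ.contDiff_normed
    hf.continuous.locallyIntegrable, ρ.hasCompactSupport_normed.convolution _ hfs,
    hsupp.trans ((Metric.cthickening_mono (min_le_right _ _) _).trans h₃)⟩, fun x => ⟨?_, ?_⟩⟩
  · rw [← dist_eq_norm, dist_comm]
    refine ρ.dist_normed_convolution_le hf.continuous.aestronglyMeasurable fun y hy => ?_
    exact (h₁ (lt_of_lt_of_le (Metric.mem_ball.1 hy) ((min_le_left _ _).trans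
      (min_le_left _ _)))).le
  · have hd : fderiv ℝ φ x =
        convolution (ρ.normed volume) (fderiv ℝ f) (ContinuousLinearMap.lsmul ℝ ℝ) volume x :=
      (hfs.hasFDerivAt_convolution_right (ContinuousLinearMap.lsmul ℝ ℝ)
        ρ.continuous_normed.locallyIntegrable hf x).fderiv
    have he : ‖∇ f x - ∇ φ x‖ = ‖fderiv ℝ f x - fderiv ℝ φ x‖ := by
      rw [gradient, gradient, ← map_sub, LinearIsometryEquiv.norm_map]
    rw [he, ← dist_eq_norm, dist_comm, hd]
    refine ρ.dist_normed_convolution_le hf'.aestronglyMeasurable fun y hy => ?_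
    exact (h₂ (lt_of_lt_of_le (Metric.mem_ball.1 hy) ((min_le_left _ _).trans
      (min_le_right _ _)))).le

/-- `C^1` functions with compact support in the interior of `M` belong to `W_0^{1,p}(M)`. -/
theorem mem_sobolevZero_of_contDiff (hM : IsCompact M) {f : Euc d → ℝ} (hf : ContDiff ℝ 1 f)
    (hfs : HasCompactSupport f) (hfM : tsupport f ⊆ interior M)
    {w : LpScalar p M × LpVector p M} (h1 : w.1 =ᵐ[volume.restrict M] f)
    (h2 : w.2 =ᵐ[volume.restrict M] ∇ f) : w ∈ sobolevZero p M := by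
  have : IsFiniteMeasure ((volume : Measure (Euc d)).restrict M) :=
    isFiniteMeasure_restrict.2 hM.measure_lt_top.ne
  choose φ hφ hle using fun n : ℕ => exists_isTestFunction_near isOpen_interior hf hfs hfM
    (Nat.one_div_pos_of_nat (n := n) (α := ℝ))
  have hlim : Tendsto (fun n : ℕ => (volume.restrict M univ) ^ (ENNReal.ofReal p).toReal⁻¹ *
      ENNReal.ofReal (1 / ((n : ℝ) + 1))) atTop (𝓝 0) := by
    have := (ENNReal.continuous_ofReal.tendsto 0).comp
      (tendsto_one_div_add_atTop_nhds_zero_nat (𝕜 := ℝ))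
    rw [ENNReal.ofReal_zero] at this
    simpa using ENNReal.Tendsto.const_mul this (Or.inr
      (ENNReal.rpow_ne_top_of_nonneg (by positivity) (measure_ne_top (volume.restrict M) univ)))
  refine mem_sobolevZero_iff.2 ⟨φ, hφ, ?_, ?_⟩
  · refine tendsto_of_tendsto_of_tendsto_of_le_of_le tendsto_const_nhds hlim
      (fun n => zero_le) fun n => eLpNorm_le_of_ae_bound (h1.mono fun x hx => ?_)
    rw [hx]; exact (hle n x).1
  · refine tendsto_of_tendsto_of_tendsto_of_le_of_le tendsto_const_nhds hlim
      (fun n => zero_le) fun n => eLpNorm_le_of_ae_bound (h2.mono fun x hx => ?_)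
    rw [hx]; exact (hle n x).2

end SobolevZero

/-! ### Consequences of the Lipschitz boundary -/

section LipschitzBoundary

variable {d : ℕ} {M : Set (Euc d)}

theorem orthogonalProjectionOnto_orthogonal_add_smul (e x : Euc d) (t : ℝ) :
    (ℝ ∙ e)ᗮ.orthogonalProjectionOnto (x + t • e) = (ℝ ∙ e)ᗮ.orthogonalProjectionOnto x := by
  rw [map_add, map_smul, add_eq_left]
  have : (ℝ ∙ e)ᗮ.orthogonalProjectionOnto e = 0 :=
    Submodule.orthogonalProjectionOnto_orthogonal_apply_eq_zero (Submodule.mem_span_singleton_self e)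
  rw [this, smul_zero]

/-- The graph of a Lipschitz function is a null set. -/
theorem volume_graph_eq_zero {e : Euc d} (he : ‖e‖ = 1) {γ : (ℝ ∙ e)ᗮ → ℝ} (hγ : Continuous γ) :
    volume {y : Euc d | γ ((ℝ ∙ e)ᗮ.orthogonalProjectionOnto y) = inner ℝ e y} = 0 := by
  have hin : ∀ (x : Euc d) (t : ℝ), inner ℝ e (x + t • e) = inner ℝ e x + t := fun x t => by
    rw [inner_add_right, inner_smul_right, real_inner_self_eq_norm_sq, he]; ring
  -- The translates of a graph by `e / (n + 1)` are pairwise disjoint and the shifts are bounded,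
  -- which forces measure zero.
  refine Measure.addHaar_eq_zero_of_disjoint_translates volume
    (fun n : ℕ => (1 / ((n : ℝ) + 1)) • e) ?_ ?_ ?_
  · refine (Metric.isBounded_closedBall (x := (0 : Euc d)) (r := 1)).subset ?_
    rintro _ ⟨n, rfl⟩
    rw [mem_closedBall_zero_iff, norm_smul, he, mul_one, Real.norm_of_nonneg (by positivity)]
    exact Nat.one_div_le_one_div (Nat.zero_le n) |>.trans (by simp)
  · intro m n hmn
    rw [Function.onFun, Set.disjoint_left]
    rintro _ ⟨_, rfl, a, ha, rfl⟩ ⟨_, rfl, b, hb, hab⟩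
    simp only [mem_ofPred_eq] at ha hb
    have hab' : b + (1 / ((n : ℝ) + 1)) • e = a + (1 / ((m : ℝ) + 1)) • e := by
      simpa [add_comm] using hab
    have h1 := congrArg (ℝ ∙ e)ᗮ.orthogonalProjectionOnto hab'
    have h2 := congrArg (inner ℝ e) hab'
    rw [orthogonalProjectionOnto_orthogonal_add_smul,
      orthogonalProjectionOnto_orthogonal_add_smul] at h1
    rw [hin, hin, ← ha, ← hb, h1, add_left_cancel_iff] at h2
    have h3 : (n : ℝ) + 1 = m + 1 := by
      have := congrArg (fun t : ℝ => t⁻¹) h2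
      simpa using this
    exact hmn (by exact_mod_cast (add_right_cancel h3).symm)
  · refine (isClosed_eq ?_ ?_).measurableSet
    · exact hγ.comp (ContinuousLinearMap.continuous _)
    · fun_prop

/-- Near a frontier point the strict epigraph is open and contained in `M`, so the frontier lies
locally in the graph. -/
theorem volume_frontier_eq_zero (hM : IsClosed M) (hLip : HasLipschitzBoundary M) :
    volume (frontier M) = 0 := by
  refine measure_null_of_locally_null _ fun x hx => ?_
  obtain ⟨U, e, γ, K, hU, hxU, he, hγ, hMU⟩ := hLip x hx
  refine ⟨_, mem_nhdsWithin_of_mem_nhds (hU.mem_nhds hxU) |> inter_mem self_mem_nhdsWithin,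
    measure_mono_null ?_ (volume_graph_eq_zero he hγ.continuous)⟩
  rintro y ⟨hy, hyU⟩
  have hyM : y ∈ M := hM.frontier_subset hy
  have hle : γ ((ℝ ∙ e)ᗮ.orthogonalProjectionOnto y) ≤ inner ℝ e y := (hMU.le ⟨hyM, hyU⟩).1
  refine hle.eq_of_not_lt fun hlt => ?_
  have hopen : IsOpen ({y : Euc d | γ ((ℝ ∙ e)ᗮ.orthogonalProjectionOnto y) < inner ℝ e y} ∩ U) :=
    (isOpen_lt (hγ.continuous.comp (ContinuousLinearMap.continuous _)) (by fun_prop)).inter hU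
  have hsub : {y : Euc d | γ ((ℝ ∙ e)ᗮ.orthogonalProjectionOnto y) < inner ℝ e y} ∩ U ⊆ M :=
    by
    rintro z ⟨hz, hzU⟩
    exact (hMU.ge ⟨le_of_lt (α := ℝ) hz, hzU⟩).1
  exact hy.2 (interior_maximal hsub hopen ⟨hlt, hyU⟩)

/-- A small shift of a frontier point in the direction `e` lands in the open strict epigraph. -/
theorem interior_nonempty_of_hasLipschitzBoundary (hM : IsClosed M) (hbd : (frontier M).Nonempty)
    (hLip : HasLipschitzBoundary M) : (interior M).Nonempty := by
  obtain ⟨x, hx⟩ := hbd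
  obtain ⟨U, e, γ, K, hU, hxU, he, hγ, hMU⟩ := hLip x hx
  have hle : γ ((ℝ ∙ e)ᗮ.orthogonalProjectionOnto x) ≤ inner ℝ e x :=
    (hMU.le ⟨hM.frontier_subset hx, hxU⟩).1
  have hopen : IsOpen ({y : Euc d | γ ((ℝ ∙ e)ᗮ.orthogonalProjectionOnto y) < inner ℝ e y} ∩ U) :=
    (isOpen_lt (hγ.continuous.comp (ContinuousLinearMap.continuous _)) (by fun_prop)).inter hU
  have hsub : {y : Euc d | γ ((ℝ ∙ e)ᗮ.orthogonalProjectionOnto y) < inner ℝ e y} ∩ U ⊆ M :=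
    by
    rintro z ⟨hz, hzU⟩
    exact (hMU.ge ⟨le_of_lt (α := ℝ) hz, hzU⟩).1
  have hc : Tendsto (fun t : ℝ => x + t • e) (𝓝[>] 0) (𝓝 x) := by
    have : Continuous fun t : ℝ => x + t • e := by fun_prop
    simpa using (this.tendsto 0).mono_left nhdsWithin_le_nhds
  obtain ⟨t, htU, ht⟩ := ((hc.eventually (hU.mem_nhds hxU)).and self_mem_nhdsWithin).exists
  refine ⟨x + t • e, interior_maximal hsub hopen ⟨?_, htU⟩⟩
  rw [mem_ofPred_eq, orthogonalProjectionOnto_orthogonal_add_smul, inner_add_right,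
    inner_smul_right, real_inner_self_eq_norm_sq, he]
  have : 0 < t := ht
  linarith

end LipschitzBoundary

/-! ### Invariance of `W_0^{1,p}` under the diffeomorphism -/

section Diffeomorphism

variable {d : ℕ} {p : ℝ} {M : Set (Euc d)} {T : PartialEquiv (Euc d) (Euc d)}

/-- Differentiating `S.symm ∘ S = id` shows that the derivative at `x` is injective, hence
surjective in finite dimension, so `S` maps neighbourhoods of `x` onto neighbourhoods of `S x`. For
`S.symm` a derivative within `M` is enough, since it is not yet known that `S x` is interior. -/
theorem mem_interior_of_contDiffOn {S : PartialEquiv (Euc d) (Euc d)} (hs : S.source = M)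
    (ht : S.target = M) (h1 : ContDiffOn ℝ 1 S M) (h2 : ContDiffOn ℝ 1 S.symm M) {x : Euc d}
    (hx : x ∈ interior M) : S x ∈ interior M := by
  have hxM : x ∈ M := interior_subset hx
  have hMx : M ∈ 𝓝 x := mem_interior_iff_mem_nhds.1 hx
  have hmaps : MapsTo S M M := by have := S.mapsTo; rwa [hs, ht] at this
  have hc : ContDiffAt ℝ 1 S x := (h1 x hxM).contDiffAt hMx
  have hd : HasStrictFDerivAt S (fderiv ℝ S x) x := hc.hasStrictFDerivAt one_ne_zero
  have hd2 : HasFDerivWithinAt S.symm (fderivWithin ℝ S.symm M (S x)) M (S x) :=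
    ((h2 (S x) (hmaps hxM)).differentiableWithinAt one_ne_zero).hasFDerivWithinAt
  have hcomp : HasFDerivAt (S.symm ∘ S) ((fderivWithin ℝ S.symm M (S x)).comp (fderiv ℝ S x)) x :=
    (hd2.comp x hd.hasFDerivAt.hasFDerivWithinAt hmaps).hasFDerivAt hMx
  have hid : HasFDerivAt (S.symm ∘ S) (ContinuousLinearMap.id ℝ (Euc d)) x := by
    refine (hasFDerivAt_id x).congr_of_eventuallyEq ?_
    filter_upwards [hMx] with y hy
    exact S.left_inv (by rwa [hs])
  have hinj : Function.Injective (fderiv ℝ S x) := by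
    refine Function.LeftInverse.injective (g := fderivWithin ℝ S.symm M (S x)) fun v => ?_
    exact DFunLike.congr_fun (hcomp.unique hid) v
  have hsurj : Function.Surjective (fderiv ℝ S x) :=
    (LinearMap.injective_iff_surjective (f := (fderiv ℝ S x : Euc d →ₗ[ℝ] Euc d))).1 hinj
  have hmap := hd.map_nhds_eq_of_surj (LinearMap.range_eq_top.2 hsurj)
  rw [mem_interior_iff_mem_nhds, ← hmap]
  exact mem_map.2 (mem_of_superset hMx fun y hy => hmaps hy)

/-- Near each point of `M` some derivative within `M` is continuous at that point, hence locally
bounded, and compactness makes the bound uniform. On the interior it agrees with `fderiv`. -/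
theorem exists_norm_fderiv_le_of_contDiffOn (hM : IsCompact M) {f : Euc d → Euc d}
    (hf : ContDiffOn ℝ 1 f M) : ∃ C : ℝ, ∀ x ∈ interior M, ‖fderiv ℝ f x‖ ≤ C := by
  suffices h : ∃ C : ℝ, ∀ x ∈ M ∩ interior M, ‖fderiv ℝ f x‖ ≤ C by
    rwa [inter_eq_right.2 interior_subset] at h
  refine hM.induction_on (p := fun s => ∃ C : ℝ, ∀ y ∈ s ∩ interior M, ‖fderiv ℝ f y‖ ≤ C)
    ⟨0, by simp⟩ ?_ ?_ ?_
  · rintro s t hst ⟨C, hC⟩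
    exact ⟨C, fun y hy => hC y ⟨hst hy.1, hy.2⟩⟩
  · rintro s t ⟨C, hC⟩ ⟨C', hC'⟩
    refine ⟨max C C', ?_⟩
    rintro y ⟨hy | hy, hyM⟩
    · exact (hC y ⟨hy, hyM⟩).trans (le_max_left _ _)
    · exact (hC' y ⟨hy, hyM⟩).trans (le_max_right _ _)
  · intro x hx
    have h := hf x hx
    rw [← zero_add (1 : WithTop ℕ∞), contDiffWithinAt_succ_iff_hasFDerivWithinAt' (by simp)] at h
    obtain ⟨u, hu, -, -, f', hf', hc⟩ := h
    rw [insert_eq_of_mem hx] at hu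
    refine ⟨_, inter_mem hu (hc.continuousWithinAt.norm.eventually
      (gt_mem_nhds (lt_add_one ‖f' x‖))), ‖f' x‖ + 1, ?_⟩
    rintro y ⟨⟨hyu, hy⟩, hyM⟩
    rw [((hf' y hyu).hasFDerivAt (mem_interior_iff_mem_nhds.1 hyM)).fderiv]
    exact le_of_lt (α := ℝ) hy

theorem IsVolumePreservingDiffeo.mapsTo_symm (hT : IsVolumePreservingDiffeo M T) :
    MapsTo T.symm M M := by
  have := T.mapsTo_symm
  rwa [hT.source_eq, hT.target_eq] at this

theorem IsVolumePreservingDiffeo.mem_interior (hT : IsVolumePreservingDiffeo M T)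
    {x : Euc d} (hx : x ∈ interior M) : T x ∈ interior M :=
  mem_interior_of_contDiffOn hT.source_eq hT.target_eq hT.contDiffOn hT.contDiffOn_symm hx

/-- `T.symm` agrees on `M` with a measure preserving map. -/
theorem IsVolumePreservingDiffeo.exists_measurePreserving (hT : IsVolumePreservingDiffeo M T)
    (hM : MeasurableSet M) : ∃ g : Euc d → Euc d,
      MeasurePreserving g (volume.restrict M) (volume.restrict M) ∧ ∀ x ∈ M, g x = T.symm x := by
  classical
  -- `T.symm` is arbitrary outside `M`; replacing it there by the identity gives a globally
  -- measurable map.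
  refine ⟨M.piecewise T.symm id, ⟨?_, ?_⟩, fun x hx => piecewise_eq_of_mem _ _ _ hx⟩
  · exact hT.contDiffOn_symm.continuousOn.measurable_piecewise continuousOn_id hM
  · ext A hA
    have hmeas : Measurable (M.piecewise T.symm id) :=
      hT.contDiffOn_symm.continuousOn.measurable_piecewise continuousOn_id hM
    rw [Measure.map_apply hmeas hA, Measure.restrict_apply (hmeas hA), Measure.restrict_apply hA,
      ← hT.volume_image _ inter_subset_right (hA.inter hM)]
    congr 1
    ext y
    constructor
    · rintro ⟨hy, hyM⟩
      rw [mem_preimage, piecewise_eq_of_mem _ _ _ hyM] at hy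
      exact ⟨T.symm y, ⟨hy, hT.mapsTo_symm hyM⟩, T.right_inv (by rwa [hT.target_eq])⟩
    · rintro ⟨x, ⟨hxA, hxM⟩, rfl⟩
      have hx : x ∈ T.source := by rwa [hT.source_eq]
      have hTx : T x ∈ M := by rw [← hT.target_eq]; exact T.mapsTo hx
      refine ⟨?_, hTx⟩
      rwa [mem_preimage, piecewise_eq_of_mem _ _ _ hTx, T.left_inv hx]

/-- The support lies in the compact set `T '' tsupport φ`, which is inside the interior of `M`. The
indicator discards the arbitrary values of `T.symm` outside `M`. -/
theorem IsVolumePreservingDiffeo.indicator_comp_symm (hT : IsVolumePreservingDiffeo M T)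
    {φ : Euc d → ℝ} (hφ : ContDiff ℝ 1 φ) (hφs : HasCompactSupport φ)
    (hφM : tsupport φ ⊆ interior M) :
    ContDiff ℝ 1 (M.indicator (φ ∘ T.symm)) ∧ HasCompactSupport (M.indicator (φ ∘ T.symm)) ∧
      tsupport (M.indicator (φ ∘ T.symm)) ⊆ interior M := by
  have hcomp : IsCompact (T '' tsupport φ) := hφs.isCompact.image_of_continuousOn
    (hT.contDiffOn.continuousOn.mono (hφM.trans interior_subset))
  have hint : T '' tsupport φ ⊆ interior M := by
    rintro _ ⟨x, hx, rfl⟩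
    exact hT.mem_interior (hφM hx)
  have hzero : ∀ y ∉ T '' tsupport φ, M.indicator (φ ∘ T.symm) y = 0 := by
    intro y hy
    by_cases hyM : y ∈ M
    · rw [indicator_of_mem hyM]
      refine image_eq_zero_of_notMem_tsupport (f := φ) fun h => hy ⟨_, h, T.right_inv ?_⟩
      rwa [hT.target_eq]
    · exact indicator_of_notMem hyM _
  have hts : tsupport (M.indicator (φ ∘ T.symm)) ⊆ T '' tsupport φ :=
    closure_minimal (Function.support_subset_iff'.2 hzero) hcomp.isClosed
  refine ⟨contDiff_iff_contDiffAt.2 fun y => ?_, hcomp.of_isClosed_subset isClosed_closure hts,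
    hts.trans hint⟩
  by_cases hy : y ∈ interior M
  · have hMy : M ∈ 𝓝 y := mem_interior_iff_mem_nhds.1 hy
    refine (hφ.contDiffAt.comp y ((hT.contDiffOn_symm y (interior_subset hy)).contDiffAt hMy))
      |>.congr_of_eventuallyEq ?_
    filter_upwards [hMy] with z hz
    exact indicator_of_mem hz _
  · refine contDiffAt_const (c := (0 : ℝ)) |>.congr_of_eventuallyEq ?_
    filter_upwards [hcomp.isClosed.isOpen_compl.mem_nhds fun h => hy (hint h)] with z hz
    exact hzero z hz

theorem IsVolumePreservingDiffeo.norm_gradient_indicator_comp_symm_le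
    (hT : IsVolumePreservingDiffeo M T) {φ : Euc d → ℝ} (hφ : ContDiff ℝ 1 φ) {y : Euc d}
    (hy : y ∈ interior M) :
    ‖∇ (M.indicator (φ ∘ T.symm)) y‖ ≤ ‖fderiv ℝ T.symm y‖ * ‖∇ φ (T.symm y)‖ := by
  have hMy : M ∈ 𝓝 y := mem_interior_iff_mem_nhds.1 hy
  have he : M.indicator (φ ∘ T.symm) =ᶠ[𝓝 y] φ ∘ T.symm := by
    filter_upwards [hMy] with z hz
    exact indicator_of_mem hz _
  have hd : DifferentiableAt ℝ T.symm y :=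
    ((hT.contDiffOn_symm y (interior_subset hy)).contDiffAt hMy).differentiableAt one_ne_zero
  rw [norm_gradient, norm_gradient, he.fderiv_eq,
    fderiv_comp _ (hφ.differentiable one_ne_zero _) hd, mul_comm]
  exact ContinuousLinearMap.opNorm_comp_le _ _

variable [Fact (1 ≤ ENNReal.ofReal p)]

theorem eq_of_mem_sobolevZero_of_fst_eq (hM : IsCompact M) (hfr : volume (frontier M) = 0)
    {v w : LpScalar p M × LpVector p M} (hv : v ∈ sobolevZero p M) (hw : w ∈ sobolevZero p M)
    (h : v.1 = w.1) : v = w := by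
  refine Prod.ext h (Lp.ext ?_)
  have h1 := (memW0_of_mem_sobolevZero hM hfr hv (ae_eq_rfl (f := v.1))).2
  have h2 := (memW0_of_mem_sobolevZero hM hfr hw (ae_eq_rfl (f := w.1))).2
  rw [← h] at h2
  exact h1.symm.trans h2

/-- `C` bounds `DT⁻¹` on the interior. Composition with a measure-preserving map is isometric in
`L^p`, so the chain rule costs only this factor. -/
theorem IsVolumePreservingDiffeo.exists_bound_of_mem_testPairs
    (hT : IsVolumePreservingDiffeo M T) (hM : IsCompact M) (hfr : volume (frontier M) = 0)
    {g : Euc d → Euc d} (hg : MeasurePreserving g (volume.restrict M) (volume.restrict M))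
    (hgT : ∀ x ∈ M, g x = T.symm x) :
    ∃ C : ℝ, ∀ s ∈ testPairs p M, ∃ r ∈ sobolevZero p M,
      r.1 = Lp.compMeasurePreserving g hg s.1 ∧ ‖r.2‖ ≤ C * ‖s.2‖ := by
  obtain ⟨C, hC⟩ := exists_norm_fderiv_le_of_contDiffOn hM hT.contDiffOn_symm
  refine ⟨C, ?_⟩
  rintro s ⟨φ, hφ, h1, h2⟩
  obtain ⟨c1, c2, c3⟩ := hT.indicator_comp_symm hφ.contDiff_one hφ.hasCompactSupport
    hφ.tsupport_subset
  set ψ := M.indicator (φ ∘ T.symm) with hψ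
  have m2 : MemLp (∇ ψ) (ENNReal.ofReal p) (volume.restrict M) :=
    ((continuous_gradient c1).memLp_of_hasCompactSupport (hasCompactSupport_gradient c2)).restrict M
  have hM' : ∀ᵐ x ∂((volume : Measure (Euc d)).restrict M), x ∈ M :=
    ae_restrict_mem hM.measurableSet
  have hint : ∀ᵐ x ∂((volume : Measure (Euc d)).restrict M), x ∈ interior M := by
    rw [← Measure.restrict_congr_set (interior_ae_eq_of_null_frontier hfr)]
    exact ae_restrict_mem isOpen_interior.measurableSet
  have e1 : Lp.compMeasurePreserving g hg s.1 =ᵐ[volume.restrict M] ψ := by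
    filter_upwards [Lp.coeFn_compMeasurePreserving s.1 hg, hg.quasiMeasurePreserving.ae h1, hM']
      with x k1 k2 k3
    rw [k1, Function.comp_apply, k2, hψ, indicator_of_mem k3, hgT x k3, Function.comp_apply]
  refine ⟨(Lp.compMeasurePreserving g hg s.1, m2.toLp _),
    mem_sobolevZero_of_contDiff hM c1 c2 c3 e1 m2.coeFn_toLp, rfl, ?_⟩
  rw [← Lp.norm_compMeasurePreserving s.2 hg]
  refine Lp.norm_le_mul_norm_of_ae_le_mul ?_
  filter_upwards [Lp.coeFn_compMeasurePreserving s.2 hg, hg.quasiMeasurePreserving.ae h2, hM',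
    hint, m2.coeFn_toLp] with x k1 k2 k3 k4 k5
  rw [k5, k1, Function.comp_apply, k2, hgT x k3]
  exact (hT.norm_gradient_indicator_comp_symm_le hφ.contDiff_one k4).trans
    (mul_le_mul_of_nonneg_right (hC x k4) (norm_nonneg _))

/-- `W_0^{1,p}(M)` is invariant under composition with `T⁻¹`. -/
theorem IsVolumePreservingDiffeo.exists_mem_sobolevZero
    (hT : IsVolumePreservingDiffeo M T) (hM : IsCompact M) (hfr : volume (frontier M) = 0)
    {g : Euc d → Euc d} (hg : MeasurePreserving g (volume.restrict M) (volume.restrict M))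
    (hgT : ∀ x ∈ M, g x = T.symm x) {w : LpScalar p M × LpVector p M}
    (hw : w ∈ sobolevZero p M) :
    ∃ r ∈ sobolevZero p M, r.1 = Lp.compMeasurePreserving g hg w.1 := by
  obtain ⟨C, hC⟩ := hT.exists_bound_of_mem_testPairs (p := p) hM hfr hg hgT
  choose! r hr hr1 hr2 using hC
  obtain ⟨s, hs, hlim⟩ := mem_closure_iff_seq_limit.1 hw
  have hlim' := (Prod.tendsto_iff s w).1 hlim
  -- The `r` are merely chosen, but the function component determines the gradient component, so `r`
  -- respects differences; the norm bound then carries the Cauchy property over.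
  have hsub : ∀ m n, r (s m) - r (s n) = r (s m - s n) := by
    intro m n
    have h0 : s m - s n ∈ testPairs p M := (testPairs p M).sub_mem (hs m) (hs n)
    refine eq_of_mem_sobolevZero_of_fst_eq hM hfr
      ((sobolevZero p M).sub_mem (hr _ (hs m)) (hr _ (hs n))) (hr _ h0) ?_
    rw [Prod.fst_sub, hr1 _ (hs m), hr1 _ (hs n), hr1 _ h0, Prod.fst_sub, map_sub]
  have hcau : CauchySeq fun n => (r (s n)).2 := by
    rw [cauchySeq_iff_tendsto_dist_atTop_0]
    have h1 := (cauchySeq_iff_tendsto_dist_atTop_0.1 hlim'.2.cauchySeq).const_mul C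
    rw [mul_zero] at h1
    refine squeeze_zero (fun _ => dist_nonneg) (fun n => ?_) h1
    rw [dist_eq_norm, dist_eq_norm, ← Prod.snd_sub, hsub, ← Prod.snd_sub]
    exact hr2 _ ((testPairs p M).sub_mem (hs _) (hs _))
  obtain ⟨h, hh⟩ := cauchySeq_tendsto_of_complete hcau
  have h1 : Tendsto (fun n => (r (s n)).1) atTop (𝓝 (Lp.compMeasurePreserving g hg w.1)) := by
    simp only [hr1 _ (hs _)]
    exact ((Lp.isometry_compMeasurePreserving hg).continuous.tendsto _).comp hlim'.1
  exact ⟨(_, h), isClosed_sobolevZero.mem_of_tendsto (h1.prodMk_nhds hh)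
    (Eventually.of_forall fun n => hr _ (hs n)), rfl⟩

omit [Fact (1 ≤ ENNReal.ofReal p)] in
theorem compMeasurePreserving_ae_eq_pushforward (hM : MeasurableSet M) {g : Euc d → Euc d}
    (hg : MeasurePreserving g (volume.restrict M) (volume.restrict M))
    (hgT : ∀ x ∈ M, g x = T.symm x) {x : LpScalar p M} {u : Euc d → ℝ}
    (hu : x =ᵐ[volume.restrict M] u) :
    Lp.compMeasurePreserving g hg x =ᵐ[volume.restrict M] pushforward T u := by
  filter_upwards [Lp.coeFn_compMeasurePreserving x hg, hg.quasiMeasurePreserving.ae hu,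
    ae_restrict_mem hM] with y k1 k2 k3
  rw [k1, Function.comp_apply, k2, hgT y k3, pushforward, Function.comp_apply]

end Diffeomorphism

/-! ### Differentiability of the `p`-th power of the `L^p` norm -/

section Derivative

variable {H : Type*} [NormedAddCommGroup H] [InnerProductSpace ℝ H] {α : Type*}
  [MeasurableSpace α] {μ : Measure α} {p : ℝ}

/-- For `p < 2` the power is singular at `ξ = 0`; the inner product supplies the missing factor
`‖ξ‖`, which gives growth of order `p - 1`. -/
theorem norm_rpow_sub_two_mul_inner_le (ξ η : H) :
    ‖‖ξ‖ ^ (p - 2) * inner ℝ ξ η‖ ≤ ‖ξ‖ ^ (p - 1) * ‖η‖ := by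
  rcases eq_or_ne ξ 0 with rfl | h
  · rw [inner_zero_left, mul_zero, norm_zero]; positivity
  · have h0 : 0 < ‖ξ‖ := norm_pos_iff.2 h
    rw [norm_mul, Real.norm_of_nonneg (by positivity : 0 ≤ ‖ξ‖ ^ (p - 2)),
      show p - 1 = p - 2 + 1 by ring, Real.rpow_add_one h0.ne', mul_assoc]
    gcongr
    exact norm_inner_le_norm ξ η

/-- Differentiation under the integral sign: for `|t| < 1` the integrand's derivative is dominated
by `p * (‖a x‖ + ‖b x‖) ^ p`. -/
theorem hasDerivAt_norm_lp_rpow [Fact (1 ≤ ENNReal.ofReal p)] (hp : 1 < p)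
    (a b : Lp H (ENNReal.ofReal p) μ) :
    HasDerivAt (fun t : ℝ => ‖a + t • b‖ ^ p)
      (p * ∫ x, ‖a x‖ ^ (p - 2) * inner ℝ (a x) (b x) ∂μ) 0 := by
  have hp0 : 0 < p := by linarith
  have hfun : (fun t : ℝ => ‖a + t • b‖ ^ p) = fun t => ∫ x, ‖a x + t • b x‖ ^ p ∂μ := by
    funext t
    rw [lp_norm_rpow hp0]
    refine integral_congr_ae ?_
    filter_upwards [Lp.coeFn_add a (t • b), Lp.coeFn_smul t b] with x h1 h2
    rw [h1, Pi.add_apply, h2, Pi.smul_apply]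
  have hma := Lp.aestronglyMeasurable a
  have hmb := Lp.aestronglyMeasurable b
  have hbound : Integrable (fun x => p * (‖a x‖ + ‖b x‖) ^ p) μ := by
    have h := ((Lp.memLp a).norm.add (Lp.memLp b).norm).integrable_norm_rpow
      (by simpa using hp0) ENNReal.ofReal_ne_top
    rw [ENNReal.toReal_ofReal hp0.le] at h
    refine (h.congr (ae_of_all _ fun x => ?_)).const_mul p
    change ‖‖a x‖ + ‖b x‖‖ ^ p = _
    rw [Real.norm_of_nonneg (by positivity)]
  have key := hasDerivAt_integral_of_dominated_loc_of_deriv_le (μ := μ) (x₀ := (0 : ℝ))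
    (F := fun t x => ‖a x + t • b x‖ ^ p)
    (F' := fun t x => p * (‖a x + t • b x‖ ^ (p - 2) * inner ℝ (a x + t • b x) (b x)))
    (bound := fun x => p * (‖a x‖ + ‖b x‖) ^ p) (Metric.ball_mem_nhds 0 one_pos)
    (Eventually.of_forall fun t => ?_) ?_ ?_ ?_ hbound ?_
  · rw [hfun, ← integral_const_mul]
    simpa using key.2
  · exact ((hma.add (hmb.const_smul t)).norm.aemeasurable.pow_const p).aestronglyMeasurable
  · simpa using integrable_lp_norm_rpow hp0 a
  · refine AEStronglyMeasurable.const_mul ?_ p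
    simp only [zero_smul, add_zero]
    exact (hma.norm.aemeasurable.pow_const _).aestronglyMeasurable.mul (hma.inner hmb)
  · refine ae_of_all _ fun x t ht => ?_
    have ht1 : ‖t‖ ≤ 1 := by simpa using (mem_ball_zero_iff.1 ht).le
    have h1 : ‖a x + t • b x‖ ≤ ‖a x‖ + ‖b x‖ := by
      refine (norm_add_le _ _).trans ?_
      rw [norm_smul]
      gcongr
      exact mul_le_of_le_one_left (norm_nonneg _) ht1
    rw [norm_mul, Real.norm_of_nonneg hp0.le]
    gcongr
    refine (norm_rpow_sub_two_mul_inner_le _ _).trans ?_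
    calc _ ≤ (‖a x‖ + ‖b x‖) ^ (p - 1) * (‖a x‖ + ‖b x‖) := by
          refine mul_le_mul (Real.rpow_le_rpow (norm_nonneg _) h1 (by linarith))
            (le_add_of_nonneg_left (norm_nonneg _)) (norm_nonneg _) (by positivity)
      _ = _ := by
          rw [← Real.rpow_add_one' (by positivity) (by linarith)]
          congr 1; ring
  · refine ae_of_all _ fun x t _ => ?_
    have h1 : HasDerivAt (fun t : ℝ => a x + t • b x) (b x) t := by
      simpa using ((hasDerivAt_id t).smul_const (b x)).const_add (a x)
    have h2 := (hasFDerivAt_norm_rpow (a x + t • b x) hp).comp_hasDerivAt t h1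
    refine h2.congr_deriv ?_
    rw [smul_apply, innerSL_apply_apply, smul_eq_mul, mul_assoc]

end Derivative

/-! ### The dynamic energy: minimizer, least value and eigenfunction -/

section Eigenfunction

variable {d : ℕ} {p : ℝ} {M : Set (Euc d)} {T : PartialEquiv (Euc d) (Euc d)}
  [Fact (1 ≤ ENNReal.ofReal p)]

variable (p) in
/-- The triples `(u, ∇u, ∇(u ∘ g))` with `u` and `u ∘ g` in `W_0^{1,p}(M)`. -/
def dynSobolevZero (g : Euc d → Euc d)
    (hg : MeasurePreserving g (volume.restrict M) (volume.restrict M)) :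
    Submodule ℝ (LpScalar p M × LpVector p M × LpVector p M) :=
  (sobolevZero p M).comap (LinearMap.id.prodMap (LinearMap.fst ℝ _ _)) ⊓
    (sobolevZero p M).comap ((Lp.compMeasurePreservingₗ ℝ g hg).prodMap (LinearMap.snd ℝ _ _))

variable {g : Euc d → Euc d} {hg : MeasurePreserving g (volume.restrict M) (volume.restrict M)}

theorem mem_dynSobolevZero {w : LpScalar p M × LpVector p M × LpVector p M} :
    w ∈ dynSobolevZero p g hg ↔ (w.1, w.2.1) ∈ sobolevZero p M ∧
      (Lp.compMeasurePreserving g hg w.1, w.2.2) ∈ sobolevZero p M := Iff.rfl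

theorem isClosed_dynSobolevZero : IsClosed (dynSobolevZero p g hg :
    Set (LpScalar p M × LpVector p M × LpVector p M)) := by
  have h1 : Continuous fun w : LpScalar p M × LpVector p M × LpVector p M => (w.1, w.2.1) := by
    fun_prop
  have h2 : Continuous fun w : LpScalar p M × LpVector p M × LpVector p M =>
      ((Lp.compMeasurePreserving g hg w.1 : LpScalar p M), w.2.2) :=
    ((Lp.isometry_compMeasurePreserving hg).continuous.comp continuous_fst).prodMk
      (continuous_snd.comp continuous_snd)
  exact (isClosed_sobolevZero.preimage h1).inter (isClosed_sobolevZero.preimage h2)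

omit [Fact (1 ≤ ENNReal.ofReal p)] in
theorem G_eq_norm_rpow (hp : 0 < p) {x : LpScalar p M} {u : Euc d → ℝ}
    (h : x =ᵐ[volume.restrict M] u) : G p M u = ‖x‖ ^ p := by
  rw [lp_norm_rpow hp, G]
  exact integral_congr_ae (h.mono fun y hy => by simp only [hy, Real.norm_eq_abs])

omit [Fact (1 ≤ ENNReal.ofReal p)] in
theorem F_eq_norm_rpow (hp : 0 < p) {y : LpVector p M} {u : Euc d → ℝ}
    (h : weakGradient M u =ᵐ[volume.restrict M] y) : F p M u = ‖y‖ ^ p := by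
  rw [lp_norm_rpow hp, F]
  exact integral_congr_ae (h.mono fun y hy => by simp only [hy])

/-- What membership in `dynSobolevZero` says about the underlying function. -/
theorem memW0_of_mem_dynSobolevZero (hM : IsCompact M) (hfr : volume (frontier M) = 0)
    (hgT : ∀ x ∈ M, g x = T.symm x) {w : LpScalar p M × LpVector p M × LpVector p M}
    (hw : w ∈ dynSobolevZero p g hg) {u : Euc d → ℝ} (hu : w.1 =ᵐ[volume.restrict M] u) :
    MemW0 p M u ∧ MemW0 p M (pushforward T u) ∧ weakGradient M u =ᵐ[volume.restrict M] w.2.1 ∧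
      weakGradient M (pushforward T u) =ᵐ[volume.restrict M] w.2.2 := by
  have h1 := memW0_of_mem_sobolevZero hM hfr (mem_dynSobolevZero.1 hw).1 hu
  have h2 := memW0_of_mem_sobolevZero hM hfr (mem_dynSobolevZero.1 hw).2
    (compMeasurePreserving_ae_eq_pushforward hM.measurableSet hg hgT hu)
  exact ⟨h1.1, h2.1, h1.2, h2.2⟩

theorem MemW0.exists_mem_dynSobolevZero (hT : IsVolumePreservingDiffeo M T) (hM : IsCompact M)
    (hfr : volume (frontier M) = 0) (hgT : ∀ x ∈ M, g x = T.symm x) {u : Euc d → ℝ}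
    (hu : MemW0 p M u) : ∃ w ∈ dynSobolevZero p g hg, w.1 =ᵐ[volume.restrict M] u := by
  obtain ⟨w, hw, hwu, -⟩ := hu.exists_mem_sobolevZero
  obtain ⟨r, hr, hr1⟩ := hT.exists_mem_sobolevZero hM hfr hg hgT hw
  exact ⟨(w.1, w.2, r.2), mem_dynSobolevZero.2 ⟨hw, by rw [← hr1]; exact hr⟩, hwu⟩

theorem exists_mem_sobolevZero_ne_zero (hint : (interior M).Nonempty) :
    ∃ w ∈ sobolevZero p M, w.1 ≠ 0 := by
  obtain ⟨c, hc⟩ := hint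
  obtain ⟨r, hr, hrM⟩ := Metric.isOpen_iff.1 isOpen_interior c hc
  let φ : ContDiffBump c := ⟨r / 4, r / 2, by positivity, by linarith⟩
  have hφ : IsTestFunction (interior M) φ := ⟨φ.contDiff, φ.hasCompactSupport, by
    rw [φ.tsupport_eq]
    exact (Metric.closedBall_subset_ball (by change r / 2 < r; linarith)).trans hrM⟩
  have m1 : MemLp φ (ENNReal.ofReal p) (volume.restrict M) :=
    (hφ.contDiff.continuous.memLp_of_hasCompactSupport hφ.hasCompactSupport).restrict M
  have m2 : MemLp (∇ φ) (ENNReal.ofReal p) (volume.restrict M) :=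
    ((continuous_gradient hφ.contDiff_one).memLp_of_hasCompactSupport
      (hasCompactSupport_gradient hφ.hasCompactSupport)).restrict M
  refine ⟨(m1.toLp _, m2.toLp _), subset_closure ⟨φ, hφ, m1.coeFn_toLp, m2.coeFn_toLp⟩, ?_⟩
  intro h0
  have hae : (φ : Euc d → ℝ) =ᵐ[volume.restrict M] 0 :=
    m1.coeFn_toLp.symm.trans (Lp.eq_zero_iff_ae_eq_zero.1 h0)
  have hnull : volume.restrict M {x | φ x ≠ 0} = 0 := ae_iff.1 hae
  have hball : Metric.ball c (r / 2) ⊆ M :=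
    (Metric.ball_subset_ball (by linarith)).trans (hrM.trans interior_subset)
  have hpos : 0 < volume (Metric.ball c (r / 2)) := Metric.measure_ball_pos _ _ (by positivity)
  rw [show {x | φ x ≠ 0} = Metric.ball c (r / 2) from φ.support_eq,
    Measure.restrict_apply Metric.isOpen_ball.measurableSet, inter_eq_left.2 hball] at hnull
  exact hpos.ne' hnull

/-- The Euler–Lagrange equation of a minimizer. -/
theorem integral_eq_of_minimizer (hp : 1 < p)
    {W : Submodule ℝ (LpScalar p M × LpVector p M × LpVector p M)}
    {w : LpScalar p M × LpVector p M × LpVector p M} (hw : w ∈ W) (h1 : ‖w.1‖ = 1) {l : ℝ}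
    (hl : (‖w.2.1‖ ^ p + ‖w.2.2‖ ^ p) / 2 = l)
    (hmin : ∀ v ∈ W, l * ‖v.1‖ ^ p ≤ (‖v.2.1‖ ^ p + ‖v.2.2‖ ^ p) / 2)
    {v : LpScalar p M × LpVector p M × LpVector p M} (hv : v ∈ W) :
    ((∫ x in M, ‖w.2.1 x‖ ^ (p - 2) * inner ℝ (w.2.1 x) (v.2.1 x)) +
      ∫ x in M, ‖w.2.2 x‖ ^ (p - 2) * inner ℝ (w.2.2 x) (v.2.2 x)) / 2 =
      l * ∫ x in M, ‖w.1 x‖ ^ (p - 2) * inner ℝ (w.1 x) (v.1 x) := by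
  have hd := (((hasDerivAt_norm_lp_rpow hp w.2.1 v.2.1).add
    (hasDerivAt_norm_lp_rpow hp w.2.2 v.2.2)).div_const 2).sub
    ((hasDerivAt_norm_lp_rpow hp w.1 v.1).const_mul l)
  -- The energy minus `l * ‖·‖ ^ p` is nonnegative on `W` and vanishes at `w`, so no Lagrange
  -- multiplier is needed.
  have hlm : IsLocalMin (fun t : ℝ => (‖w.2.1 + t • v.2.1‖ ^ p + ‖w.2.2 + t • v.2.2‖ ^ p) / 2 -
      l * ‖w.1 + t • v.1‖ ^ p) 0 := by
    refine Eventually.of_forall fun t => ?_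
    have h2 := hmin _ (W.add_mem hw (W.smul_mem t hv))
    simp only [Prod.fst_add, Prod.snd_add, Prod.smul_fst, Prod.smul_snd] at h2
    simp only [zero_smul, add_zero, h1, Real.one_rpow, mul_one, hl, sub_self]
    linarith
  have h0 := hlm.hasDerivAt_eq_zero hd
  have hp0 : p ≠ 0 := by linarith
  apply mul_left_cancel₀ hp0
  linarith

theorem dynF_eq_of_mem_dynSobolevZero (hp : 0 < p) (hM : IsCompact M)
    (hfr : volume (frontier M) = 0) (hgT : ∀ x ∈ M, g x = T.symm x)
    {w : LpScalar p M × LpVector p M × LpVector p M} (hw : w ∈ dynSobolevZero p g hg)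
    {u : Euc d → ℝ} (hu : w.1 =ᵐ[volume.restrict M] u) :
    dynF p M T u = (‖w.2.1‖ ^ p + ‖w.2.2‖ ^ p) / 2 := by
  obtain ⟨-, -, h1, h2⟩ := memW0_of_mem_dynSobolevZero hM hfr hgT hw hu
  rw [dynF, F_eq_norm_rpow hp h1, F_eq_norm_rpow hp h2]

/-- Compactness uses the bound on `∇u` alone. Positivity comes from Poincaré: `1 = ‖u‖ ≤ C * ‖∇u‖`.
-/
theorem exists_minimizer_dynSobolevZero (hp : 1 < p) (hpd : p < d) (hM : IsCompact M)
    (hfr : volume (frontier M) = 0) (hint : (interior M).Nonempty)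
    (hT : IsVolumePreservingDiffeo M T) (hgT : ∀ x ∈ M, g x = T.symm x) :
    ∃ w ∈ dynSobolevZero p g hg, ‖w.1‖ = 1 ∧ 0 < (‖w.2.1‖ ^ p + ‖w.2.2‖ ^ p) / 2 ∧
      ∀ v ∈ dynSobolevZero p g hg, (‖w.2.1‖ ^ p + ‖w.2.2‖ ^ p) / 2 * ‖v.1‖ ^ p ≤
        (‖v.2.1‖ ^ p + ‖v.2.2‖ ^ p) / 2 := by
  have htb : ∀ R : ℝ, TotallyBounded
      {x : LpScalar p M | ∃ w ∈ dynSobolevZero p g hg, w.1 = x ∧ ‖w.2.1‖ ≤ R} := fun R =>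
    (totallyBounded_of_mem_sobolevZero hp hpd hM R).subset (by
      rintro _ ⟨w, hw, rfl, hR⟩
      exact ⟨(w.1, w.2.1), (mem_dynSobolevZero.1 hw).1, rfl, hR⟩)
  have hne : ∃ w ∈ dynSobolevZero p g hg, w.1 ≠ 0 := by
    obtain ⟨w, hw, h0⟩ := exists_mem_sobolevZero_ne_zero (p := p) hint
    obtain ⟨r, hr, hr1⟩ := hT.exists_mem_sobolevZero hM hfr hg hgT hw
    exact ⟨(w.1, w.2, r.2), mem_dynSobolevZero.2 ⟨hw, by rw [← hr1]; exact hr⟩, h0⟩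
  obtain ⟨w, hw, hw1, hmin⟩ := exists_minimizer hp
    (fun δ hδ => exists_lp_norm_sub_rpow_le (E := Euc d) hp hδ) (dynSobolevZero p g hg)
    isClosed_dynSobolevZero htb hne
  refine ⟨w, hw, hw1, ?_, hmin⟩
  obtain ⟨C, hC, h⟩ := exists_norm_le_of_mem_sobolevZero hp hpd hM
  have h1 : ‖w.1‖ ≤ C * ‖w.2.1‖ := h (w.1, w.2.1) (mem_dynSobolevZero.1 hw).1
  rw [hw1] at h1
  have h2 : 0 < ‖w.2.1‖ := pos_of_mul_pos_right (one_pos.trans_le h1) hC.le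
  positivity

/-- By invariance under `T_*`, every competitor in `nonzeroW0` lifts to a triple in
`dynSobolevZero`, so minimality among triples is minimality of the Rayleigh quotient. -/
theorem isLeast_dynJ_of_minimizer (hp : 0 < p) (hM : IsCompact M)
    (hfr : volume (frontier M) = 0) (hT : IsVolumePreservingDiffeo M T)
    (hgT : ∀ x ∈ M, g x = T.symm x) {w : LpScalar p M × LpVector p M × LpVector p M}
    (hw : w ∈ dynSobolevZero p g hg) (hw1 : ‖w.1‖ = 1)
    {l : ℝ} (hl : (‖w.2.1‖ ^ p + ‖w.2.2‖ ^ p) / 2 = l)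
    (hmin : ∀ v ∈ dynSobolevZero p g hg, l * ‖v.1‖ ^ p ≤ (‖v.2.1‖ ^ p + ‖v.2.2‖ ^ p) / 2) :
    (w.1 : Euc d → ℝ) ∈ nonzeroW0 p M ∧ dynJ p M T w.1 = l ∧
      IsLeast (dynJ p M T '' nonzeroW0 p M) l := by
  have hJ : dynJ p M T w.1 = l := by
    rw [dynJ, dynF_eq_of_mem_dynSobolevZero hp hM hfr hgT hw ae_eq_rfl,
      G_eq_norm_rpow hp (x := w.1) ae_eq_rfl, hw1, Real.one_rpow, div_one, hl]
  have hmem : (w.1 : Euc d → ℝ) ∈ nonzeroW0 p M := by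
    refine ⟨(memW0_of_mem_dynSobolevZero hM hfr hgT hw (ae_eq_rfl (f := w.1))).1, fun h0 => ?_⟩
    rw [Lp.eq_zero_iff_ae_eq_zero.2 h0, norm_zero] at hw1
    exact zero_ne_one hw1
  refine ⟨hmem, hJ, ⟨_, hmem, hJ⟩, ?_⟩
  rintro _ ⟨u, ⟨huW, hu0⟩, rfl⟩
  obtain ⟨v, hv, hvu⟩ := huW.exists_mem_dynSobolevZero (hg := hg) hT hM hfr hgT
  have hpos : 0 < ‖v.1‖ := by
    refine norm_pos_iff.2 fun h0 => hu0 ?_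
    exact hvu.symm.trans (Lp.eq_zero_iff_ae_eq_zero.1 h0)
  rw [dynJ, dynF_eq_of_mem_dynSobolevZero hp hM hfr hgT hv hvu, G_eq_norm_rpow hp hvu,
    le_div_iff₀ (by positivity)]
  exact hmin v hv

theorem isWeakEigenfunction_of_minimizer (hp : 1 < p) (hM : IsCompact M)
    (hfr : volume (frontier M) = 0) (hT : IsVolumePreservingDiffeo M T)
    (hgT : ∀ x ∈ M, g x = T.symm x) {w : LpScalar p M × LpVector p M × LpVector p M}
    (hw : w ∈ dynSobolevZero p g hg) (hw1 : ‖w.1‖ = 1)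
    {l : ℝ} (hl : (‖w.2.1‖ ^ p + ‖w.2.2‖ ^ p) / 2 = l)
    (hmin : ∀ v ∈ dynSobolevZero p g hg, l * ‖v.1‖ ^ p ≤ (‖v.2.1‖ ^ p + ‖v.2.2‖ ^ p) / 2) :
    IsWeakEigenfunction p M T l w.1 := by
  intro v hv
  obtain ⟨-, -, hgu, hgTu⟩ := memW0_of_mem_dynSobolevZero hM hfr hgT hw (ae_eq_rfl (f := w.1))
  obtain ⟨r, hr, hrv⟩ := hv.exists_mem_dynSobolevZero (hg := hg) hT hM hfr hgT
  obtain ⟨-, -, hgv, hgTv⟩ := memW0_of_mem_dynSobolevZero hM hfr hgT hr hrv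
  have hEL := integral_eq_of_minimizer hp hw hw1 hl hmin hr
  have hL : ∀ {a b : Euc d → ℝ} {y z : LpVector p M},
      weakGradient M a =ᵐ[volume.restrict M] y → weakGradient M b =ᵐ[volume.restrict M] z →
      pLaplacian p M a b = - ∫ x in M, ‖y x‖ ^ (p - 2) * inner ℝ (y x) (z x) := by
    intro a b y z ha hb
    rw [pLaplacian, neg_inj]
    refine integral_congr_ae ?_
    filter_upwards [ha, hb] with x k1 k2
    rw [k1, k2]
  have e3 : ∫ x in M, |w.1 x| ^ (p - 2) * w.1 x * v x =
      ∫ x in M, ‖w.1 x‖ ^ (p - 2) * inner ℝ (w.1 x) (r.1 x) := by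
    refine integral_congr_ae ?_
    filter_upwards [hrv] with x k
    rw [← k, Real.norm_eq_abs, mul_assoc, real_inner_eq_re_inner, RCLike.inner_apply]
    simp [mul_comm]
  rw [e3, ← hEL, dynPLaplacian, hL hgu hgv, hL hgTu hgTv]
  ring

end Eigenfunction

end DynPLaplace

end

theorem mainTheorem3 (d : ℕ) (hd : 2 ≤ d) (p : ℝ) (hp1 : 1 < p) (hp2 : p < 2)
    (M : Set (EuclideanSpace ℝ (Fin d))) (hM : IsCompact M) (hbd : (frontier M).Nonempty)
    (hLip : DynPLaplace.HasLipschitzBoundary M)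
    (T : PartialEquiv (EuclideanSpace ℝ (Fin d)) (EuclideanSpace ℝ (Fin d)))
    (hT : DynPLaplace.IsVolumePreservingDiffeo M T) :
    (∀ u, DynPLaplace.MemW0 p M u → DynPLaplace.MemW0 p M (DynPLaplace.pushforward T u)) ∧
    0 < DynPLaplace.dynLambda p M T ∧
    ∃ u ∈ DynPLaplace.nonzeroW0 p M,
      DynPLaplace.dynJ p M T u = DynPLaplace.dynLambda p M T ∧
      DynPLaplace.IsWeakEigenfunction p M T (DynPLaplace.dynLambda p M T) u := by
  have hp0 : 0 < p := by linarith
  have hpd : p < d := hp2.trans_le (by exact_mod_cast hd)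
  have : Fact (1 ≤ ENNReal.ofReal p) := ⟨by simpa using ENNReal.ofReal_le_ofReal hp1.le⟩
  have hfr := DynPLaplace.volume_frontier_eq_zero hM.isClosed hLip
  obtain ⟨g, hg, hgT⟩ := hT.exists_measurePreserving hM.measurableSet
  obtain ⟨w, hw, hw1, hpos, hmin⟩ := DynPLaplace.exists_minimizer_dynSobolevZero (hg := hg) hp1 hpd
    hM hfr (DynPLaplace.interior_nonempty_of_hasLipschitzBoundary hM.isClosed hbd hLip) hT hgT
  obtain ⟨hmem, hJ, hleast⟩ :=
    DynPLaplace.isLeast_dynJ_of_minimizer hp0 hM hfr hT hgT hw hw1 rfl hmin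
  have hlam : DynPLaplace.dynLambda p M T = _ := hleast.csInf_eq
  rw [hlam]
  refine ⟨fun u hu => ?_, hpos, w.1, hmem, hJ,
    DynPLaplace.isWeakEigenfunction_of_minimizer hp1 hM hfr hT hgT hw hw1 rfl hmin⟩
  obtain ⟨r, hr, hru⟩ := hu.exists_mem_dynSobolevZero (hg := hg) hT hM hfr hgT
  exact (DynPLaplace.memW0_of_mem_dynSobolevZero hM hfr hgT hr hru).2.1
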